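/- Let $\mathbb{D}$ be the open unit disc. Let $H^2(\mathbb{D})$ be the Hilbert space of holomorphic functions $f(z)=\sum_{n\ge 0} a_n z^n$ on $\mathbb{D}$ with $\|f\|^2=\sum_n |a_n|^2<\infty$, and let $H^2(\mathbb{D}^2)$ be the Hilbert space of holomorphic functions $f(z,w)=\sum_{m,n\ge 0} a_{mn}z^m w^n$ on $\mathbb{D}^2$ with $\|f\|^2=\sum_{m,n} |a_{mn}|^2<\infty$; it is identified with the Hilbert space tensor product $H^2(\mathbb{D})\otimes H^2(\mathbb{D})$ by $(f\otimes g)(z,w)=f(z)g(w)$. Let $M_z$ and $M_w$ be the operators of multiplication by the coordinate functions $z$ and $w$ on $H^2(\mathbb{D}^2)$. An inner function is a bounded holomorphic function on $\mathbb{D}$ whose radial limits have modulus $1$ almost everywhere on the unit circle. For an inner function $\theta$ put $\mathcal{Q}_\theta=H^2(\mathbb{D})\ominus\theta H^2(\mathbb{D})$. For a pair $(T_1,T_2)$ of commuting bounded operators on a Hilbert space $\mathcal{H}$, the rank of $(T_1,T_2)$ is the least cardinality of a set $E\subseteq\mathcal{H}$ such that the closed linear span of $\{T_1^{k}T_2^{l}x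 : x\in E,\ k,l\ge 0\}$ is $\mathcal{H}$. **Theorem.** Let $\varphi,\psi\in H^\infty(\mathbb{D})$ be inner functions with $\mathcal{Q}_\varphi\neq\{0\}$ and $\mathcal{Q}_\psi\neq\{0\}$ (equivalently, $\varphi$ and $\psi$ are not constant), and let $$\mathcal{S}=(\mathcal{Q}_\varphi\otimes\mathcal{Q}_\psi)^\perp\subseteq H^2(\mathbb{D}^2),$$ where $\mathcal{Q}_\varphi\otimes\mathcal{Q}_\psi$ is the closed linear span of the functions $f\otimes g$ with $f\in\mathcal{Q}_\varphi$, $g\in\mathcal{Q}_\psi$. Then $\mathcal{S}$ is a closed subspace invariant under $M_z$ and $M_w$, and the rank of the pair $(M_z|_{\mathcal{S}},M_w|_{\mathcal{S}})$ is exactly $2$. -/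

import Mathlib

open Filter Topology MeasureTheory
open scoped Complex.UnitDisc lp ENNReal

noncomputable section

/-! ### Functions given by square summable power series -/

theorem memlp_two_iff {K : Type} {a : K → ℂ} :
    Memℓp a 2 ↔ Summable fun k => ‖a k‖ ^ 2 := by
  rw [memℓp_gen_iff (by norm_num)]
  norm_num

theorem summable_mul_lp {K : Type} (a : ℓ²(K, ℂ)) {b : K → ℂ}
    (hb : Summable fun k => ‖b k‖ ^ 2) : Summable fun k => a k * b k := by
  have ha : Summable fun k => ‖a k‖ ^ 2 := memlp_two_iff.1 (lp.memℓp a)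
  refine Summable.of_norm_bounded (ha.add hb) fun k => ?_
  rw [norm_mul]
  nlinarith [sq_nonneg (‖a k‖ - ‖b k‖), sq_nonneg (‖a k‖), sq_nonneg (‖b k‖)]

/-- The linear map sending a square summable family `a` to the function `x ↦ ∑ₖ aₖ mₖ(x)`. -/
def seriesMap {K X : Type} (m : K → X → ℂ) (hm : ∀ x, Summable fun k => ‖m k x‖ ^ 2) :
    ℓ²(K, ℂ) →ₗ[ℂ] (X → ℂ) where
  toFun a x := ∑' k, a k * m k x
  map_add' a b := by
    funext x
    simp only [lp.coeFn_add, Pi.add_apply, add_mul]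
    exact (summable_mul_lp a (hm x)).tsum_add (summable_mul_lp b (hm x))
  map_smul' c a := by
    funext x
    simp only [lp.coeFn_smul, Pi.smul_apply, smul_eq_mul, RingHom.id_apply, mul_assoc]
    exact tsum_mul_left

theorem summable_disc (z : 𝔻) : Summable fun n : ℕ => ‖(z : ℂ) ^ n‖ ^ 2 := by
  have h := summable_geometric_of_lt_one (sq_nonneg ‖(z : ℂ)‖) z.sq_norm_lt_one
  refine h.congr fun n => ?_
  rw [norm_pow, ← pow_mul, ← pow_mul, mul_comm]

theorem summable_bidisc (p : 𝔻 × 𝔻) :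
    Summable fun k : ℕ × ℕ => ‖(p.1 : ℂ) ^ k.1 * (p.2 : ℂ) ^ k.2‖ ^ 2 := by
  have h := (summable_disc p.1).mul_of_nonneg (summable_disc p.2)
    (fun n => sq_nonneg _) (fun n => sq_nonneg _)
  refine h.congr fun k => ?_
  rw [norm_mul, mul_pow]

/-- `a ↦ ∑ aₙ zⁿ` on the unit disc. -/
def discSeries : ℓ²(ℕ, ℂ) →ₗ[ℂ] (𝔻 → ℂ) :=
  seriesMap (fun n z => (z : ℂ) ^ n) summable_disc

/-- `a ↦ ∑ aₘₙ zᵐ wⁿ` on the bidisc. -/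
def bidiscSeries : ℓ²(ℕ × ℕ, ℂ) →ₗ[ℂ] (𝔻 × 𝔻 → ℂ) :=
  seriesMap (fun k p => (p.1 : ℂ) ^ k.1 * (p.2 : ℂ) ^ k.2) summable_bidisc

/-- A power series converging to zero on the disc has zero coefficients. -/
theorem coeff_eq_zero {c : ℕ → ℂ} (h : ∀ z : 𝔻, HasSum (fun n => c n * (z : ℂ) ^ n) 0) :
    c = 0 := by
  have h1 : HasFPowerSeriesAt (0 : ℂ → ℂ) (FormalMultilinearSeries.ofScalars ℂ c) 0 := by
    rw [hasFPowerSeriesAt_iff]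
    filter_upwards [Metric.ball_mem_nhds (0 : ℂ) one_pos] with z hz
    have := h (Complex.UnitDisc.mk z (by simpa using hz))
    simpa [FormalMultilinearSeries.coeff_ofScalars, mul_comm] using this
  have h2 := h1.eq_zero
  funext n
  have h3 := FormalMultilinearSeries.coeff_ofScalars (𝕜 := ℂ) (p := c) (n := n)
  rw [h2] at h3
  exact h3.symm

theorem discSeries_injective : Function.Injective discSeries := by
  rw [injective_iff_map_eq_zero]
  intro a ha
  ext n
  refine congrFun (coeff_eq_zero (c := a) fun z => ?_) n
  have := (summable_mul_lp a (summable_disc z)).hasSum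
  rwa [show (∑' n, a n * (z : ℂ) ^ n) = 0 from congrFun ha z] at this

theorem bidiscSeries_injective : Function.Injective bidiscSeries := by
  rw [injective_iff_map_eq_zero]
  intro a ha
  have hrow (m : ℕ) : Summable fun n => ‖a (m, n)‖ ^ 2 :=
    (memlp_two_iff.1 (lp.memℓp a)).comp_injective (Prod.mk_right_injective m)
  have hrow' (m : ℕ) (w : 𝔻) : Summable fun n => a (m, n) * (w : ℂ) ^ n :=
    summable_mul_lp ⟨fun n => a (m, n), memlp_two_iff.2 (hrow m)⟩ (summable_disc w)
  have h1 (w : 𝔻) (m : ℕ) : ∑' n, a (m, n) * (w : ℂ) ^ n = 0 := by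
    refine congrFun (coeff_eq_zero (c := fun m => ∑' n, a (m, n) * (w : ℂ) ^ n) fun z => ?_) m
    have hs := (summable_mul_lp a (summable_bidisc (z, w))).hasSum
    rw [show (∑' k : ℕ × ℕ, a k * ((z : ℂ) ^ k.1 * (w : ℂ) ^ k.2)) = 0 from
      congrFun ha (z, w)] at hs
    refine hs.prod_fiberwise fun m => ?_
    refine ((hrow' m w).hasSum.mul_right ((z : ℂ) ^ m)).congr_fun ?_
    intro n
    simp only
    ring
  ext ⟨m, n⟩
  refine congrFun (coeff_eq_zero (c := fun n => a (m, n)) fun w => ?_) n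
  have := (hrow' m w).hasSum
  rwa [h1 w m] at this

/-! ### The Hardy spaces of the disc and of the bidisc -/

/-- `H²(𝔻)`: the functions `f(z) = ∑ aₙ zⁿ` on `𝔻` with `∑ |aₙ|² < ∞`. -/
def HardyDisc : Type := LinearMap.range discSeries

/-- `H²(𝔻²)`: the functions `f(z, w) = ∑ aₘₙ zᵐ wⁿ` on `𝔻²` with `∑ |aₘₙ|² < ∞`. -/
def HardyBidisc : Type := LinearMap.range bidiscSeries

instance : AddCommGroup HardyDisc := inferInstanceAs (AddCommGroup (LinearMap.range discSeries))
instance : Module ℂ HardyDisc := inferInstanceAs (Module ℂ (LinearMap.range discSeries))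
instance : AddCommGroup HardyBidisc :=
  inferInstanceAs (AddCommGroup (LinearMap.range bidiscSeries))
instance : Module ℂ HardyBidisc := inferInstanceAs (Module ℂ (LinearMap.range bidiscSeries))

instance : FunLike HardyDisc 𝔻 ℂ where
  coe f := f.1
  coe_injective _ _ h := Subtype.ext h

instance : FunLike HardyBidisc (𝔻 × 𝔻) ℂ where
  coe f := f.1
  coe_injective _ _ h := Subtype.ext h

/-- The Taylor coefficients of a function in `H²(𝔻)`. -/
def HardyDisc.coeffs : HardyDisc ≃ₗ[ℂ] ℓ²(ℕ, ℂ) :=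
  (LinearEquiv.ofInjective discSeries discSeries_injective).symm

/-- The Taylor coefficients of a function in `H²(𝔻²)`. -/
def HardyBidisc.coeffs : HardyBidisc ≃ₗ[ℂ] ℓ²(ℕ × ℕ, ℂ) :=
  (LinearEquiv.ofInjective bidiscSeries bidiscSeries_injective).symm

/-- The norm of `H²(𝔻)` is the `ℓ²` norm of the Taylor coefficients. -/
instance : NormedAddCommGroup HardyDisc :=
  NormedAddCommGroup.induced _ _ HardyDisc.coeffs HardyDisc.coeffs.injective

/-- The inner product of `H²(𝔻)` is the `ℓ²` inner product of the Taylor coefficients. -/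
instance : InnerProductSpace ℂ HardyDisc := InnerProductSpace.induced HardyDisc.coeffs

/-- The norm of `H²(𝔻²)` is the `ℓ²` norm of the Taylor coefficients. -/
instance : NormedAddCommGroup HardyBidisc :=
  NormedAddCommGroup.induced _ _ HardyBidisc.coeffs HardyBidisc.coeffs.injective

/-- The inner product of `H²(𝔻²)` is the `ℓ²` inner product of the Taylor coefficients. -/
instance : InnerProductSpace ℂ HardyBidisc := InnerProductSpace.induced HardyBidisc.coeffs

theorem HardyDisc.eval_eq (f : HardyDisc) (z : 𝔻) :
    f z = ∑' n, HardyDisc.coeffs f n * (z : ℂ) ^ n := by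
  have h := LinearEquiv.ofInjective_apply (h := discSeries_injective) discSeries (HardyDisc.coeffs f)
  have h2 : LinearEquiv.ofInjective discSeries discSeries_injective (HardyDisc.coeffs f) = f :=
    LinearEquiv.apply_symm_apply _ _
  rw [h2] at h
  exact congrFun h z

theorem HardyBidisc.eval_eq (f : HardyBidisc) (p : 𝔻 × 𝔻) :
    f p = ∑' k, HardyBidisc.coeffs f k * ((p.1 : ℂ) ^ k.1 * (p.2 : ℂ) ^ k.2) := by
  have h := LinearEquiv.ofInjective_apply (h := bidiscSeries_injective) bidiscSeries
    (HardyBidisc.coeffs f)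
  have h2 : LinearEquiv.ofInjective bidiscSeries bidiscSeries_injective
    (HardyBidisc.coeffs f) = f := LinearEquiv.apply_symm_apply _ _
  rw [h2] at h
  exact congrFun h p

theorem HardyDisc.norm_coeffs (f : HardyDisc) : ‖HardyDisc.coeffs f‖ = ‖f‖ := rfl

theorem HardyBidisc.norm_coeffs (f : HardyBidisc) : ‖HardyBidisc.coeffs f‖ = ‖f‖ := rfl

/-- `HardyDisc.coeffs` as an isometric isomorphism. -/
def HardyDisc.coeffsIso : HardyDisc ≃ₗᵢ[ℂ] ℓ²(ℕ, ℂ) :=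
  ⟨HardyDisc.coeffs, HardyDisc.norm_coeffs⟩

instance : CompleteSpace HardyDisc :=
  HardyDisc.coeffsIso.toIsometryEquiv.completeSpace

/-- `HardyBidisc.coeffs` as an isometric isomorphism. -/
def HardyBidisc.coeffsIso : HardyBidisc ≃ₗᵢ[ℂ] ℓ²(ℕ × ℕ, ℂ) :=
  ⟨HardyBidisc.coeffs, HardyBidisc.norm_coeffs⟩

instance : CompleteSpace HardyBidisc :=
  HardyBidisc.coeffsIso.toIsometryEquiv.completeSpace

/-! ### The coordinate multiplication operators on `H²(𝔻²)` -/

theorem exists_shift (e : ℕ × ℕ → ℕ × ℕ) (he : Function.Injective e) (s : 𝔻 × 𝔻 → ℂ)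
    (hs : ∀ (k : ℕ × ℕ) (p : 𝔻 × 𝔻), (p.1 : ℂ) ^ (e k).1 * (p.2 : ℂ) ^ (e k).2 =
      s p * ((p.1 : ℂ) ^ k.1 * (p.2 : ℂ) ^ k.2)) (f : HardyBidisc) :
    ∃ g : HardyBidisc, (∀ p, g p = s p * f p) ∧ ‖g‖ = ‖f‖ := by
  set a := HardyBidisc.coeffs f with ha
  let b : ℕ × ℕ → ℂ := Function.extend e a 0
  have hb (k) : b (e k) = a k := he.extend_apply _ _ _
  have hb0 (k) (hk : k ∉ Set.range e) : b k = 0 := Function.extend_apply' _ _ _ hk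
  have hsum : Summable fun k => ‖b k‖ ^ 2 := by
    rw [← he.summable_iff (fun k hk => by simp [hb0 k hk])]
    refine (memlp_two_iff.1 (lp.memℓp a)).congr fun k => ?_
    simp [hb]
  let B : ℓ²(ℕ × ℕ, ℂ) := ⟨b, memlp_two_iff.2 hsum⟩
  have hB (k) : B k = b k := rfl
  refine ⟨HardyBidisc.coeffs.symm B, fun p => ?_, ?_⟩
  · rw [HardyBidisc.eval_eq, HardyBidisc.eval_eq, LinearEquiv.apply_symm_apply, ← ha,
      ← tsum_mul_left, ← he.tsum_eq]
    · refine tsum_congr fun k => ?_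
      rw [hB, hb, hs]
      ring
    · intro k hk
      by_contra h
      exact hk (by simp [hB, hb0 k h])
  · rw [← HardyBidisc.norm_coeffs, ← HardyBidisc.norm_coeffs, LinearEquiv.apply_symm_apply, ← ha]
    have h1 : ‖B‖ ^ 2 = ‖a‖ ^ 2 := by
      have e1 := lp.norm_rpow_eq_tsum (p := 2) (by norm_num) B
      have e2 := lp.norm_rpow_eq_tsum (p := 2) (by norm_num) a
      norm_num at e1 e2
      rw [e1, e2, ← he.tsum_eq]
      · exact tsum_congr fun k => by rw [hB, hb]
      · intro k hk
        by_contra h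
        exact hk (by simp [hB, hb0 k h])
    exact (sq_eq_sq₀ (norm_nonneg _) (norm_nonneg _)).1 h1

theorem exists_mul_fst (f : HardyBidisc) :
    ∃ g : HardyBidisc, (∀ p, g p = (p.1 : ℂ) * f p) ∧ ‖g‖ = ‖f‖ :=
  exists_shift (fun k => (k.1 + 1, k.2)) (fun k l h => by simpa [Prod.ext_iff] using h)
    (fun p => (p.1 : ℂ)) (fun k p => by simp only; ring) f

theorem exists_mul_snd (f : HardyBidisc) :
    ∃ g : HardyBidisc, (∀ p, g p = (p.2 : ℂ) * f p) ∧ ‖g‖ = ‖f‖ :=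
  exists_shift (fun k => (k.1, k.2 + 1)) (fun k l h => by simpa [Prod.ext_iff] using h)
    (fun p => (p.2 : ℂ)) (fun k p => by simp only; ring) f

/-- An operator on `H²(𝔻²)` from pointwise multiplication by a function. -/
def mulOperator (s : 𝔻 × 𝔻 → ℂ)
    (h : ∀ f : HardyBidisc, ∃ g : HardyBidisc, (∀ p, g p = s p * f p) ∧ ‖g‖ = ‖f‖) :
    HardyBidisc →L[ℂ] HardyBidisc :=
  LinearMap.mkContinuous
    { toFun := fun f => (⟨fun p => s p * f p, by
        obtain ⟨g, hg, -⟩ := h f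
        rw [← funext hg]
        exact g.2⟩ : LinearMap.range bidiscSeries)
      map_add' := fun f g => Subtype.ext (funext fun p => mul_add (s p) (f p) (g p))
      map_smul' := fun c f => Subtype.ext (funext fun p => mul_left_comm (s p) c (f p)) }
    1 (fun f => by
      obtain ⟨g, hg, hn⟩ := h f
      rw [one_mul, ← hn]
      refine le_of_eq (congrArg norm ?_)
      exact Subtype.ext (funext fun p => (hg p).symm))

/-- `M_z` : multiplication by the first coordinate on `H²(𝔻²)`. -/
def shiftZ : HardyBidisc →L[ℂ] HardyBidisc := mulOperator (fun p => (p.1 : ℂ)) exists_mul_fst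

/-- `M_w` : multiplication by the second coordinate on `H²(𝔻²)`. -/
def shiftW : HardyBidisc →L[ℂ] HardyBidisc := mulOperator (fun p => (p.2 : ℂ)) exists_mul_snd

theorem shiftZ_apply (f : HardyBidisc) (p : 𝔻 × 𝔻) : shiftZ f p = (p.1 : ℂ) * f p := rfl

theorem shiftW_apply (f : HardyBidisc) (p : 𝔻 × 𝔻) : shiftW f p = (p.2 : ℂ) * f p := rfl

/-! ### Inner functions and model spaces -/

/-- `φ` restricts to an inner function on the unit disc: it is holomorphic and bounded there, and
at almost every boundary point it has a radial limit of modulus one. -/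
structure IsInner (φ : ℂ → ℂ) : Prop where
  holomorphic : DifferentiableOn ℂ φ (Metric.ball 0 1)
  bounded : ∃ C : ℝ, ∀ z ∈ Metric.ball (0 : ℂ) 1, ‖φ z‖ ≤ C
  boundary : ∀ᵐ θ : ℝ, ∃ ζ : ℂ, ‖ζ‖ = 1 ∧
    Tendsto (fun r : ℝ => φ (r * Complex.exp (θ * Complex.I))) (𝓝[<] 1) (𝓝 ζ)

/-- `φ H²(𝔻)`, as a subspace of `H²(𝔻)`. -/
def mulSubspace (φ : ℂ → ℂ) : Submodule ℂ HardyDisc where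
  carrier := {f | ∃ g : HardyDisc, ∀ z : 𝔻, f z = φ z * g z}
  zero_mem' := ⟨0, fun z => (mul_zero (φ z)).symm⟩
  add_mem' := by
    rintro f₁ f₂ ⟨g₁, h₁⟩ ⟨g₂, h₂⟩
    refine ⟨g₁ + g₂, fun z => ?_⟩
    change f₁ z + f₂ z = φ z * (g₁ z + g₂ z)
    rw [h₁, h₂, mul_add]
  smul_mem' := by
    rintro c f ⟨g, h⟩
    refine ⟨c • g, fun z => ?_⟩
    change c * f z = φ z * (c * g z)
    rw [h, mul_left_comm]

/-- The model space `Q_φ = H²(𝔻) ⊖ φ H²(𝔻)`. -/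
def modelSpace (φ : ℂ → ℂ) : Submodule ℂ HardyDisc := (mulSubspace φ)ᗮ

/-! ### Tensor products of subspaces inside `H²(𝔻²) = H²(𝔻) ⊗ H²(𝔻)` -/

theorem tensor_mem (f g : HardyDisc) :
    (fun p : 𝔻 × 𝔻 => f p.1 * g p.2) ∈ LinearMap.range bidiscSeries := by
  set a := HardyDisc.coeffs f with ha
  set b := HardyDisc.coeffs g with hb
  have h : Summable fun k : ℕ × ℕ => ‖a k.1 * b k.2‖ ^ 2 := by
    refine ((memlp_two_iff.1 (lp.memℓp a)).mul_of_nonneg (memlp_two_iff.1 (lp.memℓp b))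
      (fun n => sq_nonneg _) (fun n => sq_nonneg _)).congr fun k => ?_
    rw [norm_mul, mul_pow]
  refine ⟨⟨fun k => a k.1 * b k.2, memlp_two_iff.2 h⟩, funext fun p => ?_⟩
  have h1 := (summable_mul_lp a (summable_disc p.1)).norm
  have h2 := (summable_mul_lp b (summable_disc p.2)).norm
  rw [HardyDisc.eval_eq, HardyDisc.eval_eq, ← ha, ← hb, tsum_mul_tsum_of_summable_norm h1 h2]
  exact tsum_congr fun k => mul_mul_mul_comm _ _ _ _

/-- The elementary tensor `f ⊗ g`, that is, the function `(z, w) ↦ f(z) g(w)` in `H²(𝔻²)`. -/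
def elemTensor (f g : HardyDisc) : HardyBidisc := ⟨fun p => f p.1 * g p.2, tensor_mem f g⟩

/-- The Hilbert space tensor product `A ⊗ B` of two subspaces of `H²(𝔻)`, as a closed subspace
of `H²(𝔻²)`. -/
def tensorSubspace (A B : Submodule ℂ HardyDisc) : Submodule ℂ HardyBidisc :=
  (Submodule.span ℂ {h | ∃ f ∈ A, ∃ g ∈ B, h = elemTensor f g}).topologicalClosure

/-! ### Submodules and rank -/

/-- `[E]_T`: the closed linear span of `{T₁ᵏ T₂ˡ x : x ∈ E, k, l ∈ ℕ}`. -/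
def generatedSubspace {H : Type} [NormedAddCommGroup H] [InnerProductSpace ℂ H]
    (T₁ T₂ : H →L[ℂ] H) (E : Set H) : Submodule ℂ H :=
  (Submodule.span ℂ {y | ∃ k l : ℕ, ∃ x ∈ E, y = (T₁ ^ k * T₂ ^ l) x}).topologicalClosure

/-- The rank of a pair of commuting operators: the least cardinality of a generating set. -/
def pairRank {H : Type} [NormedAddCommGroup H] [InnerProductSpace ℂ H]
    (T₁ T₂ : H →L[ℂ] H) : Cardinal :=
  sInf {c | ∃ E : Set H, generatedSubspace T₁ T₂ E = ⊤ ∧ c = Cardinal.mk E}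

/-- A submodule of `H²(𝔻²)`: a closed subspace that is invariant under `M_z` and `M_w`. -/
structure IsShiftSubmodule (S : Submodule ℂ HardyBidisc) : Prop where
  isClosed : IsClosed (S : Set HardyBidisc)
  invariantZ : ∀ f ∈ S, shiftZ f ∈ S
  invariantW : ∀ f ∈ S, shiftW f ∈ S

/-- The rank of a submodule `S`: the rank of the pair of restrictions `(M_z|_S, M_w|_S)`. -/
def IsShiftSubmodule.rank {S : Submodule ℂ HardyBidisc} (h : IsShiftSubmodule S) : Cardinal :=
  pairRank (shiftZ.restrict h.invariantZ) (shiftW.restrict h.invariantW)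

end

/-! Write `Φ`, `Ψ` for multiplication by `φ(z)`, `ψ(w)`. Both are isometries, and they doubly
commute because they act in different variables. From this `S = Φ H² + Ψ H²`, a sum that needs no
closure (`exists_eq_mulFst_add_mulSnd`). So `S` is invariant, and `φ ⊗ 1`, `1 ⊗ ψ` generate it: the
rank is at most two.

For the lower bound take the Hankel form `B(f, g) = ∫ f g z w conj φ(z) conj ψ(w)` over the torus.
It is bounded and symmetric, satisfies `B(pf, g) = B(f, pg)` for polynomials `p`, and vanishes when
one argument is in the range of `Φ` or `Ψ`. Hence `Φ x + Ψ y ↦ B(x, g)` and `Φ x + Ψ y ↦ B(y, g)`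
are well defined bounded functionals `α g`, `β g` on `S`. If `F = Φ a + Ψ b` were cyclic, then `α b
- β a` would vanish at every `p F`, since `B(pa, b) = B(pb, a)`; so it would vanish on `S`, and its
values on the range of `Ψ` give `B(·, a) = 0`. Now every `α g` vanishes at every `p F`, so `B = 0`
(`bilin_eq_zero_of_cyclic`). But the matrix entries of `B` are products of conjugated Taylor
coefficients of positive index of `φ` and `ψ`, and some such product is nonzero because neither
function is constant.

Boundary values enter only through `IsInner.exists_orthonormal`; afterwards everything is computed
with coefficients on monomials. -/

noncomputable section

/-! ### Boundary values and Fourier coefficients of inner functions -/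

open AddCircle in
theorem ae_haarAddCircle_of_ae_real {T : ℝ} [hT : Fact (0 < T)] {P : AddCircle T → Prop}
    (h : ∀ᵐ θ : ℝ, P θ) : ∀ᵐ x ∂(haarAddCircle : Measure (AddCircle T)), P x := by
  have h1 : ∀ᵐ y : Set.Ioc (0 : ℝ) (0 + T) ∂(Measure.comap Subtype.val volume), P (y : ℝ) :=
    (ae_restrict_iff_subtype (p := fun θ : ℝ => P θ) measurableSet_Ioc).1 (ae_restrict_of_ae h)
  have h2 : ∀ᵐ x ∂(volume : Measure (AddCircle T)), P x := by
    filter_upwards [(measurePreserving_equivIoc T (a := 0)).quasiMeasurePreserving.ae h1]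
      with x hx
    rwa [coe_equivIoc] at hx
  rw [volume_eq_smul_haarAddCircle] at h2
  rwa [Measure.ae_ennreal_smul_measure_eq] at h2
  simpa using hT.out

/-- The Fourier coefficients of an absolutely convergent power series on the circle. -/
theorem fourierCoeff_tsum_pow {T : ℝ} [Fact (0 < T)] {a : ℕ → ℂ} (ha : Summable fun n => ‖a n‖)
    (m : ℤ) :
    fourierCoeff (fun x : AddCircle T => ∑' n, a n * (AddCircle.toCircle x : ℂ) ^ n) m =
      if 0 ≤ m then a m.toNat else 0 := by
  have hpow (n : ℕ) (x : AddCircle T) : (AddCircle.toCircle x : ℂ) ^ n = fourier (n : ℤ) x := by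
    rw [fourier_apply, AddCircle.toCircle_zsmul, zpow_natCast, Circle.coe_pow]
  have hint (n : ℕ) : Integrable (fun x : AddCircle T => fourier (-m) x • (a n * fourier n x))
      AddCircle.haarAddCircle :=
    (by fun_prop : Continuous fun x : AddCircle T =>
      fourier (-m) x • (a n * fourier n x)).integrable_of_hasCompactSupport
        (HasCompactSupport.of_compactSpace _)
  have hnorm (x : AddCircle T) (n : ℤ) : ‖fourier n x‖ = 1 := by
    rw [fourier_apply, Circle.norm_coe]
  -- Absolute summability of `a` permits termwise integration.
  have h1 := hasSum_integral_of_summable_integral_norm hint (by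
    simpa only [norm_smul, norm_mul, hnorm, one_mul, mul_one, integral_const, probReal_univ,
      smul_eq_mul] using ha)
  have h2 (n : ℕ) : ∫ x : AddCircle T, fourier (-m) x • (a n * fourier n x)
      ∂AddCircle.haarAddCircle = a n * if m = n then 1 else 0 := by
    have := congrFun (fourierCoeff_fourier (T := T) n) m
    rw [Pi.single_apply] at this
    rw [← this, fourierCoeff, ← integral_const_mul]
    exact integral_congr_ae (.of_forall fun x => by simp only [smul_eq_mul]; ring)
  have h3 (x : AddCircle T) : ∑' n : ℕ, fourier (-m) x • (a n * fourier n x) =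
      fourier (-m) x • ∑' n, a n * (AddCircle.toCircle x : ℂ) ^ n := by
    simp_rw [smul_eq_mul, tsum_mul_left, hpow]
  simp_rw [h3, h2] at h1
  rw [fourierCoeff, ← h1.tsum_eq]
  split_ifs with hm
  · lift m to ℕ using hm
    rw [tsum_eq_single m]
    · simp
    · intro n hn
      simp [Ne.symm hn]
  · refine (tsum_congr fun n => ?_).trans tsum_zero
    rw [if_neg, mul_zero]
    omega

theorem hasSum_taylor_ball {φ : ℂ → ℂ} (h : DifferentiableOn ℂ φ (Metric.ball 0 1)) {z : ℂ}
    (hz : z ∈ Metric.ball (0 : ℂ) 1) :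
    HasSum (fun n : ℕ => ((n.factorial : ℂ)⁻¹ * iteratedDeriv n φ 0) * z ^ n) (φ z) := by
  have := Complex.hasSum_taylorSeries_on_ball (c := (0 : ℂ)) (r := 1) h hz
  refine this.congr_fun fun n => ?_
  simp only [smul_eq_mul, sub_zero]
  ring

open AddCircle in
/-- The boundary function of an inner function. -/
theorem IsInner.exists_boundary {φ : ℂ → ℂ} (hφ : IsInner φ) {c : ℕ → ℂ}
    (hc : ∀ z ∈ Metric.ball (0 : ℂ) 1, HasSum (fun n => c n * z ^ n) (φ z))
    [Fact (0 < 2 * Real.pi)] :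
    ∃ g : AddCircle (2 * Real.pi) → ℂ, AEStronglyMeasurable g haarAddCircle ∧
      (∀ᵐ x ∂haarAddCircle, ‖g x‖ = 1) ∧
      ∀ m : ℤ, fourierCoeff g m = if 0 ≤ m then c m.toNat else 0 := by
  classical
  -- A sequence of radii makes the boundary function an a.e. limit of countably many continuous
  -- functions, hence measurable, and allows dominated convergence.
  let r : ℕ → ℝ := fun j => 1 - 1 / ((j : ℝ) + 1)
  have hr0 (j) : 0 ≤ r j := sub_nonneg.2 (by
    rw [div_le_one (by positivity)]; linarith [(Nat.cast_nonneg j : (0 : ℝ) ≤ j)])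
  have hr1 (j) : r j < 1 := sub_lt_self _ (by positivity)
  have hr : Tendsto r atTop (𝓝[<] 1) := by
    refine tendsto_nhdsWithin_iff.2 ⟨?_, .of_forall hr1⟩
    simpa [r] using (tendsto_one_div_add_atTop_nhds_zero_nat (𝕜 := ℝ)).const_sub 1
  have hball (j) (x : AddCircle (2 * Real.pi)) :
      (r j * toCircle x : ℂ) ∈ Metric.ball (0 : ℂ) 1 := by
    rw [mem_ball_zero_iff, norm_mul, Circle.norm_coe, mul_one, Complex.norm_real,
      Real.norm_of_nonneg (hr0 j)]
    exact hr1 j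
  have hlim : ∀ᵐ x ∂(haarAddCircle : Measure (AddCircle (2 * Real.pi))), ∃ ζ : ℂ, ‖ζ‖ = 1 ∧
      Tendsto (fun j => φ (r j * toCircle x)) atTop (𝓝 ζ) := by
    refine ae_haarAddCircle_of_ae_real ?_
    filter_upwards [hφ.boundary] with θ ⟨ζ, h1, h2⟩
    refine ⟨ζ, h1, ?_⟩
    have : (toCircle (θ : AddCircle (2 * Real.pi)) : ℂ) = Complex.exp (θ * Complex.I) := by
      rw [toCircle_apply_mk, Circle.coe_exp]
      congr 2
      push_cast
      field_simp
    rw [this]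
    exact h2.comp hr
  -- Where the radial limit fails to exist `g` takes arbitrary values; this is a null set.
  choose! g hg using fun (x : AddCircle (2 * Real.pi)) (h : ∃ ζ : ℂ, ‖ζ‖ = 1 ∧
      Tendsto (fun j => φ (r j * toCircle x)) atTop (𝓝 ζ)) => h
  have hcont (j) : Continuous fun x : AddCircle (2 * Real.pi) => φ (r j * toCircle x) :=
    hφ.holomorphic.continuousOn.comp_continuous (by fun_prop) (hball j)
  refine ⟨g, ?_, ?_, fun m => ?_⟩
  · exact aestronglyMeasurable_of_tendsto_ae atTop
      (fun j => (hcont j).aestronglyMeasurable) (hlim.mono fun x hx => (hg x hx).2)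
  · exact hlim.mono fun x hx => (hg x hx).1
  obtain ⟨C, hC⟩ := hφ.bounded
  have h1 : Tendsto (fun j => fourierCoeff (fun x : AddCircle (2 * Real.pi) =>
      φ (r j * toCircle x)) m) atTop (𝓝 (fourierCoeff g m)) := by
    refine tendsto_integral_of_dominated_convergence (fun _ => C)
      (fun j => ((fourier (-m)).continuous.smul (hcont j)).aestronglyMeasurable)
      (integrable_const C) (fun j => .of_forall fun x => ?_)
      (hlim.mono fun x hx => (hg x hx).2.const_smul _)
    rw [norm_smul, fourier_apply, Circle.norm_coe, one_mul]
    exact hC _ (hball j x)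
  have h2 (j) : fourierCoeff (fun x : AddCircle (2 * Real.pi) => φ (r j * toCircle x)) m =
      if 0 ≤ m then c m.toNat * (r j : ℂ) ^ m.toNat else 0 := by
    rw [← fourierCoeff_tsum_pow (T := 2 * Real.pi) (a := fun n => c n * (r j : ℂ) ^ n)]
    · congr 1
      funext x
      rw [← (hc _ (hball j x)).tsum_eq]
      exact tsum_congr fun n => by ring
    · simpa using (hc _ (hball j 0)).summable.norm
  refine tendsto_nhds_unique h1 ?_
  simp_rw [h2]
  split_ifs
  · have h3 : Tendsto (fun j => (r j : ℂ)) atTop (𝓝 1) := by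
      exact (Complex.continuous_ofReal.tendsto' 1 1 Complex.ofReal_one).comp
        (hr.mono_right nhdsWithin_le_nhds)
    simpa using (h3.pow m.toNat).const_mul (c m.toNat)
  · exact tendsto_const_nhds

/-- The Taylor coefficients of an inner function, extended by zero to `ℤ`, have orthonormal
translates. -/
theorem IsInner.exists_orthonormal {φ : ℂ → ℂ} (hφ : IsInner φ) :
    ∃ (c : ℤ → ℂ) (u : ℤ → ℓ²(ℤ, ℂ)), (∀ n < 0, c n = 0) ∧ (∀ k n, u k n = c (n - k)) ∧
      Orthonormal ℂ u ∧
      ∀ z ∈ Metric.ball (0 : ℂ) 1, HasSum (fun n : ℕ => c n * z ^ n) (φ z) := by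
  obtain ⟨c, hc⟩ : ∃ c : ℕ → ℂ, ∀ z ∈ Metric.ball (0 : ℂ) 1, HasSum (fun n => c n * z ^ n) (φ z) :=
    ⟨_, fun z hz => hasSum_taylor_ball hφ.holomorphic hz⟩
  have : Fact (0 < 2 * Real.pi) := ⟨by positivity⟩
  obtain ⟨g, hgm, hg1, hgc⟩ := hφ.exists_boundary hc
  have hnorm (x : AddCircle (2 * Real.pi)) (n : ℤ) : ‖fourier n x‖ = 1 := by
    rw [fourier_apply, Circle.norm_coe]
  have hmem (k : ℤ) : MemLp (fun x => fourier k x * g x) 2 AddCircle.haarAddCircle := by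
    refine MemLp.of_bound ((fourier k).continuous.aestronglyMeasurable.mul hgm) 1 ?_
    filter_upwards [hg1] with x hx
    rw [norm_mul, hx, hnorm, one_mul]
  let v (k : ℤ) := (hmem k).toLp
  -- Since `|g| = 1` a.e., the factor `g` cancels from the inner products of the `e_k g`, leaving
  -- those of the characters.
  have hv : Orthonormal ℂ v := by
    rw [orthonormal_iff_ite]
    intro i j
    have h1 := fourierCoeff_fourier (T := 2 * Real.pi) j
    have h2 := congrFun h1 i
    rw [Pi.single_apply] at h2
    rw [← h2, L2.inner_def, fourierCoeff]
    refine integral_congr_ae ?_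
    filter_upwards [hg1, (hmem i).coeFn_toLp, (hmem j).coeFn_toLp] with x hx hi hj
    rw [hi, hj, RCLike.inner_apply, map_mul, ← fourier_neg]
    have : g x * (starRingEnd ℂ) (g x) = 1 := by
      rw [Complex.mul_conj, Complex.normSq_eq_norm_sq, hx]; simp
    simp only [smul_eq_mul]
    linear_combination (fourier j x * fourier (-i) x) * this
  refine ⟨fun m => if 0 ≤ m then c m.toNat else 0, fun k => fourierBasis.repr (v k),
    fun n hn => if_neg (by omega), fun k n => ?_, ?_, fun z hz => ?_⟩
  · rw [fourierBasis_repr]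
    refine Eq.trans ?_ (hgc (n - k))
    rw [fourierCoeff_congr_ae (hmem k).coeFn_toLp]
    refine integral_congr_ae (.of_forall fun x => ?_)
    have : (fourier (-(n - k)) x : ℂ) = fourier (-n) x * fourier k x := by
      rw [← fourier_add]; congr 2; ring
    simp only [smul_eq_mul, this, mul_assoc]
  · exact hv.comp_linearIsometry fourierBasis.repr.toLinearIsometry
  · simpa using hc z hz

/-! ### Elementary tensors and orthonormal families -/

/-- The elementary tensor of two square summable families. -/
def lpTensor {α β : Type} (a : ℓ²(α, ℂ)) (b : ℓ²(β, ℂ)) : ℓ²(α × β, ℂ) :=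
  ⟨fun k => a k.1 * b k.2, memlp_two_iff.2 <| by
    refine ((memlp_two_iff.1 (lp.memℓp a)).mul_of_nonneg (memlp_two_iff.1 (lp.memℓp b))
      (fun n => sq_nonneg _) (fun n => sq_nonneg _)).congr fun k => ?_
    rw [norm_mul, mul_pow]⟩

theorem lpTensor_apply {α β : Type} (a : ℓ²(α, ℂ)) (b : ℓ²(β, ℂ)) (k : α × β) :
    lpTensor a b k = a k.1 * b k.2 := rfl

theorem inner_lpTensor {α β : Type} (a a' : ℓ²(α, ℂ)) (b b' : ℓ²(β, ℂ)) :
    inner ℂ (lpTensor a b) (lpTensor a' b') = inner ℂ a a' * inner ℂ b b' := by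
  have ha : Summable fun i => ‖inner ℂ (a i) (a' i)‖ := (lp.summable_inner (𝕜 := ℂ) a a').norm
  have hb : Summable fun i => ‖inner ℂ (b i) (b' i)‖ := (lp.summable_inner (𝕜 := ℂ) b b').norm
  rw [lp.inner_eq_tsum, lp.inner_eq_tsum, lp.inner_eq_tsum,
    tsum_mul_tsum_of_summable_norm ha hb]
  refine tsum_congr fun k => ?_
  simp only [lpTensor_apply, RCLike.inner_apply, map_mul]
  ring

theorem Orthonormal.lpTensor {α β ι κ : Type} {u : ι → ℓ²(α, ℂ)} {v : κ → ℓ²(β, ℂ)}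
    (hu : Orthonormal ℂ u) (hv : Orthonormal ℂ v) :
    Orthonormal ℂ fun k : ι × κ => lpTensor (u k.1) (v k.2) := by
  classical
  rw [orthonormal_iff_ite] at hu hv ⊢
  rintro ⟨i, j⟩ ⟨i', j'⟩
  simp only [inner_lpTensor, hu, hv, Prod.mk.injEq, ite_and]
  split_ifs <;> simp

theorem HardyDisc.inner_coeffs (f g : HardyDisc) :
    inner ℂ (HardyDisc.coeffs f) (HardyDisc.coeffs g) = inner ℂ f g := rfl

theorem HardyBidisc.inner_coeffs (f g : HardyBidisc) :
    inner ℂ (HardyBidisc.coeffs f) (HardyBidisc.coeffs g) = inner ℂ f g := rfl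

theorem elemTensor_apply (f g : HardyDisc) (p : 𝔻 × 𝔻) : elemTensor f g p = f p.1 * g p.2 := rfl

theorem coeffs_elemTensor (f g : HardyDisc) :
    HardyBidisc.coeffs (elemTensor f g) = lpTensor (HardyDisc.coeffs f) (HardyDisc.coeffs g) := by
  rw [← HardyBidisc.coeffs.apply_symm_apply (lpTensor _ _)]
  congr 1
  refine DFunLike.ext _ _ fun p => ?_
  rw [elemTensor_apply, HardyBidisc.eval_eq, LinearEquiv.apply_symm_apply, HardyDisc.eval_eq,
    HardyDisc.eval_eq, tsum_mul_tsum_of_summable_norm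
    (summable_mul_lp _ (summable_disc p.1)).norm (summable_mul_lp _ (summable_disc p.2)).norm]
  exact tsum_congr fun k => mul_mul_mul_comm _ _ _ _

theorem inner_elemTensor (f g f' g' : HardyDisc) :
    inner ℂ (elemTensor f g) (elemTensor f' g') = inner ℂ f f' * inner ℂ g g' := by
  rw [← HardyBidisc.inner_coeffs, coeffs_elemTensor, coeffs_elemTensor, inner_lpTensor,
    HardyDisc.inner_coeffs, HardyDisc.inner_coeffs]

theorem Orthonormal.elemTensor {ι κ : Type} {u : ι → HardyDisc} {v : κ → HardyDisc}
    (hu : Orthonormal ℂ u) (hv : Orthonormal ℂ v) :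
    Orthonormal ℂ fun k : ι × κ => elemTensor (u k.1) (v k.2) := by
  classical
  rw [orthonormal_iff_ite] at hu hv ⊢
  rintro ⟨i, j⟩ ⟨i', j'⟩
  simp only [inner_elemTensor, hu, hv, Prod.mk.injEq, ite_and]
  split_ifs <;> simp

theorem elemTensor_add_left (f f' g : HardyDisc) :
    elemTensor (f + f') g = elemTensor f g + elemTensor f' g :=
  DFunLike.ext _ _ fun p => add_mul (f p.1) (f' p.1) (g p.2)

theorem elemTensor_add_right (f g g' : HardyDisc) :
    elemTensor f (g + g') = elemTensor f g + elemTensor f g' :=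
  DFunLike.ext _ _ fun p => mul_add (f p.1) (g p.2) (g' p.2)

/-! ### Monomial bases and point evaluations -/

/-- The monomials `zⁿ` as a Hilbert basis of `H²(𝔻)`. -/
def discBasis : HilbertBasis ℕ ℂ HardyDisc := HilbertBasis.ofRepr HardyDisc.coeffsIso

/-- The monomials `zᵐ wⁿ` as a Hilbert basis of `H²(𝔻²)`. -/
def bidiscBasis : HilbertBasis (ℕ × ℕ) ℂ HardyBidisc := HilbertBasis.ofRepr HardyBidisc.coeffsIso

theorem coeffs_discBasis (n : ℕ) : HardyDisc.coeffs (discBasis n) = lp.single 2 n (1 : ℂ) :=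
  discBasis.repr_self n

theorem coeffs_bidiscBasis (k : ℕ × ℕ) :
    HardyBidisc.coeffs (bidiscBasis k) = lp.single 2 k (1 : ℂ) :=
  bidiscBasis.repr_self k

theorem inner_discBasis (f : HardyDisc) (n : ℕ) :
    inner ℂ (discBasis n) f = HardyDisc.coeffs f n :=
  (discBasis.repr_apply_apply f n).symm

theorem discBasis_apply (n : ℕ) (z : 𝔻) : discBasis n z = (z : ℂ) ^ n := by
  rw [HardyDisc.eval_eq, coeffs_discBasis, tsum_eq_single n]
  · simp
  · intro m hm
    simp [hm]

theorem bidiscBasis_apply (k : ℕ × ℕ) (p : 𝔻 × 𝔻) :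
    bidiscBasis k p = (p.1 : ℂ) ^ k.1 * (p.2 : ℂ) ^ k.2 := by
  rw [HardyBidisc.eval_eq, coeffs_bidiscBasis, tsum_eq_single k]
  · simp
  · intro m hm
    simp [hm]

theorem elemTensor_discBasis (k : ℕ × ℕ) :
    elemTensor (discBasis k.1) (discBasis k.2) = bidiscBasis k :=
  DFunLike.ext _ _ fun p => by
    rw [elemTensor_apply, bidiscBasis_apply, discBasis_apply, discBasis_apply]

/-- Evaluation at `x` is the inner product with the reproducing kernel, whose coefficients are `conj
(m k x)`. -/
theorem continuous_seriesMap_apply {K X : Type} (m : K → X → ℂ)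
    (hm : ∀ x, Summable fun k => ‖m k x‖ ^ 2) (x : X) :
    Continuous fun a => seriesMap m hm a x := by
  let κ : ℓ²(K, ℂ) := ⟨fun k => star (m k x), memlp_two_iff.2 (by simpa using hm x)⟩
  refine (innerSL ℂ κ).continuous.congr fun a => ?_
  rw [innerSL_apply_apply, lp.inner_eq_tsum]
  refine tsum_congr fun k => ?_
  rw [RCLike.inner_apply]
  change a k * starRingEnd ℂ (star (m k x)) = _
  simp

/-- Point evaluation on `H²(𝔻)`. -/
def HardyDisc.evalCLM (z : 𝔻) : HardyDisc →L[ℂ] ℂ where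
  toFun f := f z
  map_add' _ _ := rfl
  map_smul' _ _ := rfl
  cont := ((continuous_seriesMap_apply _ summable_disc z).comp
    HardyDisc.coeffsIso.continuous).congr fun f => (HardyDisc.eval_eq f z).symm

/-- Point evaluation on `H²(𝔻²)`. -/
def HardyBidisc.evalCLM (p : 𝔻 × 𝔻) : HardyBidisc →L[ℂ] ℂ where
  toFun f := f p
  map_add' _ _ := rfl
  map_smul' _ _ := rfl
  cont := ((continuous_seriesMap_apply _ summable_bidisc p).comp
    HardyBidisc.coeffsIso.continuous).congr fun f => (HardyBidisc.eval_eq f p).symm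

/-- Reduces the operator and form identities below to a check on monomials. -/
theorem HilbertBasis.clm_ext {ι E F : Type} [NormedAddCommGroup E] [InnerProductSpace ℂ E]
    [NormedAddCommGroup F] [NormedSpace ℂ F] (b : HilbertBasis ι ℂ E) {S T : E →L[ℂ] F}
    (h : ∀ i, S (b i) = T (b i)) : S = T := by
  refine ContinuousLinearMap.ext_on (s := Set.range b) ?_ (by rintro _ ⟨i, rfl⟩; exact h i)
  rw [dense_iff_closure_eq, ← Submodule.topologicalClosure_coe, b.dense_span, Submodule.top_coe]

/-- The isometry sending a Hilbert basis to an orthonormal family. -/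
def HilbertBasis.isometry {ι E F : Type} [NormedAddCommGroup E] [InnerProductSpace ℂ E]
    [NormedAddCommGroup F] [InnerProductSpace ℂ F] [CompleteSpace F] (b : HilbertBasis ι ℂ E)
    {v : ι → F} (hv : Orthonormal ℂ v) : E →ₗᵢ[ℂ] F :=
  hv.orthogonalFamily.linearIsometry.comp b.repr.toLinearIsometry

theorem HilbertBasis.isometry_apply {ι E F : Type} [NormedAddCommGroup E] [InnerProductSpace ℂ E]
    [NormedAddCommGroup F] [InnerProductSpace ℂ F] [CompleteSpace F] (b : HilbertBasis ι ℂ E)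
    {v : ι → F} (hv : Orthonormal ℂ v) (i : ι) : b.isometry hv (b i) = v i := by
  classical
  change hv.orthogonalFamily.linearIsometry (b.repr (b i)) = v i
  rw [b.repr_self, OrthogonalFamily.linearIsometry_apply_single]
  simp

/-! ### Sequences with orthonormal translates -/

/-- A sequence supported on the nonnegative integers whose translates are orthonormal in `ℓ²(ℤ)`:
the Taylor coefficients of an inner function. -/
structure InnerSeq where
  coeff : ℤ → ℂ
  translate : ℤ → ℓ²(ℤ, ℂ)
  coeff_neg : ∀ n < 0, coeff n = 0
  translate_apply : ∀ k n, translate k n = coeff (n - k)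
  orthonormal : Orthonormal ℂ translate

/-- The restriction to `ℕ` of a sequence on `ℤ`, as Taylor coefficients. -/
def ofNatCoeffs (x : ℓ²(ℤ, ℂ)) : HardyDisc :=
  HardyDisc.coeffs.symm ⟨fun n => x (n : ℤ), memlp_two_iff.2
    ((memlp_two_iff.1 (lp.memℓp x)).comp_injective Nat.cast_injective)⟩

theorem coeffs_ofNatCoeffs (x : ℓ²(ℤ, ℂ)) (n : ℕ) : HardyDisc.coeffs (ofNatCoeffs x) n = x n := by
  rw [ofNatCoeffs, LinearEquiv.apply_symm_apply]

/-- Only one of the two vectors has to live on `ℕ`; `x` may be a backward translate that loses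
coefficients under truncation. -/
theorem inner_ofNatCoeffs (x : ℓ²(ℤ, ℂ)) {y : ℓ²(ℤ, ℂ)} (hy : ∀ n < 0, y n = 0) :
    inner ℂ (ofNatCoeffs x) (ofNatCoeffs y) = inner ℂ x y := by
  rw [← HardyDisc.inner_coeffs, lp.inner_eq_tsum, lp.inner_eq_tsum,
    ← Function.Injective.tsum_eq (Nat.cast_injective (R := ℤ))]
  · simp_rw [coeffs_ofNatCoeffs]
  · intro n hn
    by_contra h
    refine hn ?_
    change inner ℂ (x n) (y n) = 0
    rw [hy, inner_zero_right]
    by_contra h0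
    exact h ⟨n.toNat, by simp only [Int.toNat_of_nonneg (not_lt.1 h0)]⟩

namespace InnerSeq

variable (s : InnerSeq)

theorem translate_neg (k : ℕ) (m : ℤ) (hm : m < 0) : s.translate k m = 0 := by
  rw [s.translate_apply, s.coeff_neg]
  omega

/-- The functions `zᵏ φ`, where `φ` has the given Taylor coefficients. -/
def shifted (k : ℕ) : HardyDisc := ofNatCoeffs (s.translate k)

/-- The functions `(S*)ᵏ⁺¹ φ`, where `S` is the shift. -/
def backward (k : ℕ) : HardyDisc := ofNatCoeffs (s.translate (-k - 1))

theorem orthonormal_shifted : Orthonormal ℂ s.shifted := by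
  rw [orthonormal_iff_ite]
  intro i j
  rw [shifted, shifted, inner_ofNatCoeffs _ (s.translate_neg j),
    orthonormal_iff_ite.1 s.orthonormal]
  simp

/-- Orthogonality of distinct translates survives truncation because `zˡ φ` has no negative
coefficients. It makes the Hankel form vanish on multiples of `φ`. -/
theorem inner_backward_shifted (k l : ℕ) : inner ℂ (s.backward k) (s.shifted l) = 0 := by
  rw [backward, shifted, inner_ofNatCoeffs _ (s.translate_neg l)]
  exact s.orthonormal.2 (by omega)

theorem inner_backward_discBasis (k l : ℕ) :
    inner ℂ (s.backward k) (discBasis l) = starRingEnd ℂ (s.coeff (l + k + 1)) := by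
  rw [← inner_conj_symm, inner_discBasis, backward, coeffs_ofNatCoeffs, s.translate_apply]
  congr 2
  ring

theorem shifted_apply (k : ℕ) (z : 𝔻) : s.shifted k z = (z : ℂ) ^ k * s.shifted 0 z := by
  rw [HardyDisc.eval_eq, HardyDisc.eval_eq, ← tsum_mul_left,
    ← Function.Injective.tsum_eq (add_left_injective k)]
  · refine tsum_congr fun n => ?_
    simp only [shifted, coeffs_ofNatCoeffs, s.translate_apply]
    push_cast
    rw [add_sub_cancel_right, sub_zero]
    ring
  · intro n hn
    by_contra h
    refine hn ?_
    simp only [shifted, coeffs_ofNatCoeffs, s.translate_apply]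
    rw [s.coeff_neg, zero_mul]
    by_contra h0
    exact h ⟨n - k, by simp only; omega⟩

/-- Multiplication by `φ` on `H²(𝔻)`. -/
def mulDisc : HardyDisc →ₗᵢ[ℂ] HardyDisc := discBasis.isometry s.orthonormal_shifted

/-- Multiplication by `φ(z)` on `H²(𝔻²)`. -/
def mulFst : HardyBidisc →ₗᵢ[ℂ] HardyBidisc :=
  bidiscBasis.isometry (s.orthonormal_shifted.elemTensor discBasis.orthonormal)

/-- Multiplication by `φ(w)` on `H²(𝔻²)`. -/
def mulSnd : HardyBidisc →ₗᵢ[ℂ] HardyBidisc :=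
  bidiscBasis.isometry (discBasis.orthonormal.elemTensor s.orthonormal_shifted)

/-- The isometry is prescribed on monomials only; continuity of point evaluation identifies it as a
multiplication operator. -/
theorem mulDisc_apply (f : HardyDisc) (z : 𝔻) : s.mulDisc f z = s.shifted 0 z * f z := by
  have : (HardyDisc.evalCLM z).comp s.mulDisc.toContinuousLinearMap =
      s.shifted 0 z • HardyDisc.evalCLM z := by
    refine discBasis.clm_ext fun n => ?_
    change s.mulDisc (discBasis n) z = s.shifted 0 z * discBasis n z
    rw [mulDisc, HilbertBasis.isometry_apply, shifted_apply, discBasis_apply, mul_comm]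
  exact DFunLike.congr_fun this f

theorem mulFst_apply (f : HardyBidisc) (p : 𝔻 × 𝔻) :
    s.mulFst f p = s.shifted 0 p.1 * f p := by
  have : (HardyBidisc.evalCLM p).comp s.mulFst.toContinuousLinearMap =
      s.shifted 0 p.1 • HardyBidisc.evalCLM p := by
    refine bidiscBasis.clm_ext fun n => ?_
    change s.mulFst (bidiscBasis n) p = s.shifted 0 p.1 * bidiscBasis n p
    rw [mulFst, HilbertBasis.isometry_apply, elemTensor_apply, shifted_apply, bidiscBasis_apply,
      discBasis_apply]
    ring
  exact DFunLike.congr_fun this f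

theorem mulSnd_apply (f : HardyBidisc) (p : 𝔻 × 𝔻) :
    s.mulSnd f p = s.shifted 0 p.2 * f p := by
  have : (HardyBidisc.evalCLM p).comp s.mulSnd.toContinuousLinearMap =
      s.shifted 0 p.2 • HardyBidisc.evalCLM p := by
    refine bidiscBasis.clm_ext fun n => ?_
    change s.mulSnd (bidiscBasis n) p = s.shifted 0 p.2 * bidiscBasis n p
    rw [mulSnd, HilbertBasis.isometry_apply, elemTensor_apply, shifted_apply, bidiscBasis_apply,
      discBasis_apply]
    ring
  exact DFunLike.congr_fun this f

theorem mulFst_elemTensor (f g : HardyDisc) :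
    s.mulFst (elemTensor f g) = elemTensor (s.mulDisc f) g :=
  DFunLike.ext _ _ fun p => by
    rw [mulFst_apply, elemTensor_apply, elemTensor_apply, mulDisc_apply, mul_assoc]

theorem mulSnd_elemTensor (f g : HardyDisc) :
    s.mulSnd (elemTensor f g) = elemTensor f (s.mulDisc g) :=
  DFunLike.ext _ _ fun p => by
    rw [mulSnd_apply, elemTensor_apply, elemTensor_apply, mulDisc_apply, mul_left_comm]

end InnerSeq

/-! ### A bounded Hankel form -/

/-- The standard Hilbert basis of `ℓ²`. -/
def lpBasis (K : Type) : HilbertBasis K ℂ ℓ²(K, ℂ) :=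
  HilbertBasis.ofRepr (LinearIsometryEquiv.refl ℂ _)

theorem lpBasis_apply {K : Type} [DecidableEq K] (k : K) : lpBasis K k = lp.single 2 k (1 : ℂ) :=
  (lpBasis K).repr_self k

theorem star_lpBasis {K : Type} (k : K) : star (lpBasis K k) = lpBasis K k := by
  classical
  ext l
  rw [lp.star_apply, lpBasis_apply, lp.single_apply]
  by_cases h : l = k
  · subst h; simp
  · simp [h]

theorem inner_lpBasis {K : Type} (k : K) (x : ℓ²(K, ℂ)) : inner ℂ (lpBasis K k) x = x k :=
  ((lpBasis K).repr_apply_apply x k).symm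

/-- Indices of the monomials that are conjugate to `z w zᵐ wⁿ` on the torus. -/
def reflectIndex (k : ℕ × ℕ) : ℤ × ℤ := (-k.1 - 1, -k.2 - 1)

theorem reflectIndex_injective : Function.Injective reflectIndex := by
  intro k l h
  simp only [reflectIndex, Prod.mk.injEq] at h
  exact Prod.ext (by omega) (by omega)

/-- The isometry sending `zᵐ wⁿ` to the basis vector with index `(-m-1, -n-1)`. -/
def reflectIsometry : HardyBidisc →ₗᵢ[ℂ] ℓ²(ℤ × ℤ, ℂ) :=
  bidiscBasis.isometry ((lpBasis (ℤ × ℤ)).orthonormal.comp _ reflectIndex_injective)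

namespace InnerSeq

/-- The sequence `m ↦ conj (c (l - m))`. -/
def dualTranslate (s : InnerSeq) (l : ℤ) : ℓ²(ℤ, ℂ) :=
  ⟨fun m => star (s.translate 0 (l - m)), memlp_two_iff.2 (by
    simpa [Function.comp_def] using (memlp_two_iff.1 (lp.memℓp (s.translate 0))).comp_injective
      (Equiv.subLeft l).injective)⟩

theorem dualTranslate_apply (s : InnerSeq) (l m : ℤ) :
    s.dualTranslate l m = starRingEnd ℂ (s.coeff (l - m)) := by
  change starRingEnd ℂ (s.translate 0 (l - m)) = _
  rw [s.translate_apply, sub_zero]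

/-- The reflection `m ↦ i + j - m` of the summation index turns these inner products into those of
the translates. -/
theorem orthonormal_dualTranslate (s : InnerSeq) : Orthonormal ℂ s.dualTranslate := by
  rw [orthonormal_iff_ite]
  intro i j
  rw [← orthonormal_iff_ite.1 s.orthonormal i j, ← inner_conj_symm (s.translate i),
    ← inner_conj_symm (s.dualTranslate i)]
  congr 1
  rw [lp.inner_eq_tsum, lp.inner_eq_tsum, ← (Equiv.subLeft (i + j)).tsum_eq]
  refine tsum_congr fun m => ?_
  simp only [RCLike.inner_apply, dualTranslate_apply, s.translate_apply, Equiv.subLeft_apply,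
    Complex.conj_conj]
  rw [mul_comm, show i - (i + j - m) = m - j by ring, show j - (i + j - m) = m - i by ring]

/-- The isometry sending `zᵐ wⁿ` to the sequence of Fourier coefficients of
`zᵐ conj φ(z) wⁿ conj ψ(w)` on the torus. -/
def dualIsometry (s t : InnerSeq) : HardyBidisc →ₗᵢ[ℂ] ℓ²(ℤ × ℤ, ℂ) :=
  bidiscBasis.isometry ((s.orthonormal_dualTranslate.lpTensor t.orthonormal_dualTranslate).comp
    (fun k : ℕ × ℕ => ((k.1 : ℤ), (k.2 : ℤ))) fun k l h => by simpa [Prod.ext_iff] using h)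

/-- The bilinear form `∫ f g z w conj φ(z) conj ψ(w)` on `H²(𝔻²)`. -/
def hankelForm (s t : InnerSeq) : HardyBidisc →L[ℂ] HardyBidisc →L[ℂ] ℂ :=
  -- `star` undoes the conjugate linearity of the first slot, and Cauchy–Schwarz gives the bound
  -- `1`.
  (LinearMap.mk₂ ℂ (fun f g => inner ℂ (star (reflectIsometry f)) (dualIsometry s t g))
    (fun f f' g => by rw [map_add, star_add, inner_add_left])
    (fun c f g => by
      rw [map_smul, star_smul, inner_smul_left, RCLike.star_def, Complex.conj_conj, smul_eq_mul])
    (fun f g g' => by rw [map_add, inner_add_right])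
    (fun c f g => by rw [map_smul, inner_smul_right, smul_eq_mul])).mkContinuous₂ 1 fun f g => by
      refine (norm_inner_le_norm (𝕜 := ℂ) (star (reflectIsometry f))
        (dualIsometry s t g)).trans ?_
      rw [norm_star, LinearIsometry.norm_map, LinearIsometry.norm_map, one_mul]

theorem hankelForm_apply (s t : InnerSeq) (f g : HardyBidisc) :
    hankelForm s t f g = inner ℂ (star (reflectIsometry f)) (dualIsometry s t g) := rfl

/-- The entries depend only on `k + l`; the symmetry of the form and of both shifts follows from
this. -/
theorem hankelForm_basis (s t : InnerSeq) (k l : ℕ × ℕ) :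
    hankelForm s t (bidiscBasis k) (bidiscBasis l) =
      starRingEnd ℂ (s.coeff (k.1 + l.1 + 1)) * starRingEnd ℂ (t.coeff (k.2 + l.2 + 1)) := by
  rw [hankelForm_apply, reflectIsometry, HilbertBasis.isometry_apply, dualIsometry,
    HilbertBasis.isometry_apply]
  simp only [Function.comp_apply]
  rw [star_lpBasis, inner_lpBasis, lpTensor_apply, dualTranslate_apply, dualTranslate_apply]
  simp only [reflectIndex]
  congr 3 <;> ring

theorem hankelForm_symm (s t : InnerSeq) (f g : HardyBidisc) :
    hankelForm s t f g = hankelForm s t g f := by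
  have : hankelForm s t = (hankelForm s t).flip := by
    refine bidiscBasis.clm_ext fun k => bidiscBasis.clm_ext fun l => ?_
    change hankelForm s t (bidiscBasis k) (bidiscBasis l) =
      hankelForm s t (bidiscBasis l) (bidiscBasis k)
    rw [hankelForm_basis, hankelForm_basis,
      add_comm (k.1 : ℤ), add_comm (k.2 : ℤ)]
  exact DFunLike.congr_fun (DFunLike.congr_fun this f) g

theorem shiftZ_basis (k : ℕ × ℕ) : shiftZ (bidiscBasis k) = bidiscBasis (k.1 + 1, k.2) :=
  DFunLike.ext _ _ fun p => by
    rw [shiftZ_apply, bidiscBasis_apply, bidiscBasis_apply]; simp only; ring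

theorem shiftW_basis (k : ℕ × ℕ) : shiftW (bidiscBasis k) = bidiscBasis (k.1, k.2 + 1) :=
  DFunLike.ext _ _ fun p => by
    rw [shiftW_apply, bidiscBasis_apply, bidiscBasis_apply]; simp only; ring

theorem hankelForm_shiftZ (s t : InnerSeq) (f g : HardyBidisc) :
    hankelForm s t (shiftZ f) g = hankelForm s t f (shiftZ g) := by
  have : (hankelForm s t).comp shiftZ = ((hankelForm s t).flip.comp shiftZ).flip := by
    refine bidiscBasis.clm_ext fun k => bidiscBasis.clm_ext fun l => ?_
    change hankelForm s t (shiftZ (bidiscBasis k)) (bidiscBasis l) =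
      hankelForm s t (bidiscBasis k) (shiftZ (bidiscBasis l))
    rw [shiftZ_basis, shiftZ_basis, hankelForm_basis, hankelForm_basis]
    push_cast
    congr 3
    ring
  exact DFunLike.congr_fun (DFunLike.congr_fun this f) g

theorem hankelForm_shiftW (s t : InnerSeq) (f g : HardyBidisc) :
    hankelForm s t (shiftW f) g = hankelForm s t f (shiftW g) := by
  have : (hankelForm s t).comp shiftW = ((hankelForm s t).flip.comp shiftW).flip := by
    refine bidiscBasis.clm_ext fun k => bidiscBasis.clm_ext fun l => ?_
    change hankelForm s t (shiftW (bidiscBasis k)) (bidiscBasis l) =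
      hankelForm s t (bidiscBasis k) (shiftW (bidiscBasis l))
    rw [shiftW_basis, shiftW_basis, hankelForm_basis, hankelForm_basis]
    push_cast
    congr 3
    ring
  exact DFunLike.congr_fun (DFunLike.congr_fun this f) g

/-- Backward shifts of `φ` are orthogonal to `φ H²`, so this representation shows that the form
kills the ranges of both multiplications. -/
theorem hankelForm_apply_basis (s t : InnerSeq) (f : HardyBidisc) (l : ℕ × ℕ) :
    hankelForm s t f (bidiscBasis l) =
      inner ℂ (elemTensor (s.backward l.1) (t.backward l.2)) f := by
  have : (hankelForm s t).flip (bidiscBasis l) =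
      innerSL ℂ (elemTensor (s.backward l.1) (t.backward l.2)) := by
    refine bidiscBasis.clm_ext fun k => ?_
    change hankelForm s t (bidiscBasis k) (bidiscBasis l) =
      inner ℂ (elemTensor (s.backward l.1) (t.backward l.2)) (bidiscBasis k)
    rw [hankelForm_basis, ← elemTensor_discBasis, inner_elemTensor, inner_backward_discBasis,
      inner_backward_discBasis]
  exact DFunLike.congr_fun this f

theorem hankelForm_mulFst (s t : InnerSeq) (f g : HardyBidisc) :
    hankelForm s t (s.mulFst f) g = 0 := by
  have : (hankelForm s t).comp s.mulFst.toContinuousLinearMap = 0 := by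
    refine bidiscBasis.clm_ext fun k => bidiscBasis.clm_ext fun l => ?_
    change hankelForm s t (s.mulFst (bidiscBasis k)) (bidiscBasis l) = 0
    rw [hankelForm_apply_basis, mulFst, HilbertBasis.isometry_apply, inner_elemTensor,
      inner_backward_shifted, zero_mul]
  exact DFunLike.congr_fun (DFunLike.congr_fun this f) g

theorem hankelForm_mulSnd (s t : InnerSeq) (f g : HardyBidisc) :
    hankelForm s t (t.mulSnd f) g = 0 := by
  have : (hankelForm s t).comp t.mulSnd.toContinuousLinearMap = 0 := by
    refine bidiscBasis.clm_ext fun k => bidiscBasis.clm_ext fun l => ?_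
    change hankelForm s t (t.mulSnd (bidiscBasis k)) (bidiscBasis l) = 0
    rw [hankelForm_apply_basis, mulSnd, HilbertBasis.isometry_apply, inner_elemTensor,
      inner_backward_shifted, mul_zero]
  exact DFunLike.congr_fun (DFunLike.congr_fun this f) g

theorem hankelForm_ne_zero (s t : InnerSeq) {m n : ℕ} (hm : s.coeff (m + 1) ≠ 0)
    (hn : t.coeff (n + 1) ≠ 0) : hankelForm s t ≠ 0 := by
  intro h
  have := hankelForm_basis s t (m, n) (0, 0)
  rw [h] at this
  simp [hm, hn] at this

end InnerSeq

/-! ### Non-cyclicity -/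

theorem map_pow_symm {H : Type} [NormedAddCommGroup H] [NormedSpace ℂ H] {B : H →L[ℂ] H →L[ℂ] ℂ}
    {T : H →L[ℂ] H} (h : ∀ f g, B (T f) g = B f (T g)) (n : ℕ) (f g : H) :
    B ((T ^ n) f) g = B f ((T ^ n) g) := by
  induction n generalizing f g with
  | zero => rfl
  | succ n ih =>
    rw [pow_succ, mul_apply_eq_comp, ih, h, ← mul_apply_eq_comp T,
      ← pow_succ', ← pow_succ]

open ContinuousLinearMap in
/-- Let `Φ` and `Ψ` be doubly commuting isometries that commute with `Z` and `W`, and let `B` be a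
symmetric bilinear form that vanishes on their ranges and for which `Z` and `W` are symmetric. If
`Φ a + Ψ b` is cyclic for `Z` and `W` in a space containing both ranges, then `B` is zero. -/
theorem bilin_eq_zero_of_cyclic {H : Type} [NormedAddCommGroup H] [InnerProductSpace ℂ H]
    [CompleteSpace H] {Φ Ψ Z W : H →L[ℂ] H} {B : H →L[ℂ] H →L[ℂ] ℂ}
    (hΦ : adjoint Φ * Φ = 1) (hΨ : adjoint Ψ * Ψ = 1)
    (hc : Commute Φ Ψ) (hdc : Commute (adjoint Φ) Ψ)
    (hZW : Commute Z W) (hZΦ : Commute Z Φ) (hZΨ : Commute Z Ψ)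
    (hWΦ : Commute W Φ) (hWΨ : Commute W Ψ)
    (hB : ∀ f g, B f g = B g f) (hBZ : ∀ f g, B (Z f) g = B f (Z g))
    (hBW : ∀ f g, B (W f) g = B f (W g))
    (hBΦ : ∀ f g, B (Φ f) g = 0) (hBΨ : ∀ f g, B (Ψ f) g = 0)
    {S : Submodule ℂ H} (hSΦ : ∀ x, Φ x ∈ S) (hSΨ : ∀ x, Ψ x ∈ S) (a b : H)
    (hcyc : ∀ Λ : H →L[ℂ] ℂ, (∀ k l : ℕ, Λ ((Z ^ k * W ^ l) (Φ a + Ψ b)) = 0) → ∀ x ∈ S, Λ x = 0) :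
    B = 0 := by
  -- `Φ*(Φ x + Ψ y) = x + Ψ Φ* y`, and `B` does not see the second term.
  let α (g : H) : H →L[ℂ] ℂ := (B.flip g).comp (adjoint Φ)
  -- The projection `1 - Φ Φ*` removes `Φ x`, after which `Ψ*` yields `y - Φ Φ* y`; again `B`
  -- ignores the correction.
  let β (g : H) : H →L[ℂ] ℂ := (B.flip g).comp (adjoint Ψ * (1 - Φ * adjoint Φ))
  have eΦ (x) : adjoint Φ (Φ x) = x := DFunLike.congr_fun hΦ x
  have eΨ (x) : adjoint Ψ (Ψ x) = x := DFunLike.congr_fun hΨ x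
  have ec (x) : Φ (Ψ x) = Ψ (Φ x) := DFunLike.congr_fun hc x
  have edc (x) : adjoint Φ (Ψ x) = Ψ (adjoint Φ x) := DFunLike.congr_fun hdc x
  have hα (g x y : H) : α g (Φ x + Ψ y) = B x g := by
    change B (adjoint Φ (Φ x + Ψ y)) g = _
    rw [map_add, eΦ, edc, map_add, add_apply, hBΨ, add_zero]
  have hβ (g x y : H) : β g (Φ x + Ψ y) = B y g := by
    change B (adjoint Ψ ((Φ x + Ψ y) - Φ (adjoint Φ (Φ x + Ψ y)))) g = _
    rw [map_add, eΦ, edc, map_add, ec, add_sub_add_left_eq_sub, map_sub, eΨ, eΨ, map_sub,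
      sub_apply, hBΦ, sub_zero]
  have hT (k l : ℕ) (x y : H) : (Z ^ k * W ^ l) (Φ x + Ψ y) =
      Φ ((Z ^ k * W ^ l) x) + Ψ ((Z ^ k * W ^ l) y) := by
    have h1 : Commute (Z ^ k * W ^ l) Φ := (hZΦ.pow_left k).mul_left (hWΦ.pow_left l)
    have h2 : Commute (Z ^ k * W ^ l) Ψ := (hZΨ.pow_left k).mul_left (hWΨ.pow_left l)
    rw [map_add]
    exact congrArg₂ _ (DFunLike.congr_fun h1 x) (DFunLike.congr_fun h2 y)
  have hBT (k l : ℕ) (f g : H) : B ((Z ^ k * W ^ l) f) g = B f ((Z ^ k * W ^ l) g) := by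
    rw [mul_apply_eq_comp, map_pow_symm hBZ, map_pow_symm hBW, ← mul_apply_eq_comp,
      (hZW.pow_pow k l).eq]
  -- With `T = Zᵏ Wˡ`, the value on the orbit is `B(T a, b) - B(T b, a)`, zero by the symmetries of
  -- `B`.
  have h1 : ∀ x ∈ S, (α b - β a) x = 0 := hcyc _ fun k l => by
    rw [sub_apply, hT, hα, hβ, hBT, hB, sub_self]
  have ha (x : H) : B x a = 0 := by
    have := h1 _ (hSΨ x)
    have h2 := hα b 0 x
    have h3 := hβ a 0 x
    rw [map_zero, zero_add] at h2 h3
    rwa [sub_apply, h2, h3, map_zero, zero_apply, zero_sub, neg_eq_zero] at this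
  ext x g
  -- On the orbit `α g` equals `B(T a, g) = B(T g, a)`, which is now zero.
  have h2 : ∀ y ∈ S, α g y = 0 := hcyc _ fun k l => by rw [hT, hα, hBT, hB, ha]
  have h3 := hα g x 0
  rw [map_zero, add_zero] at h3
  rw [← h3, h2 _ (hSΦ x), zero_apply, zero_apply]

/-! ### Inner functions as multipliers -/

theorem IsInner.exists_innerSeq {φ : ℂ → ℂ} (hφ : IsInner φ) :
    ∃ s : InnerSeq, ∀ z : 𝔻, φ z = s.shifted 0 z := by
  obtain ⟨c, u, h1, h2, h3, h4⟩ := hφ.exists_orthonormal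
  refine ⟨⟨c, u, h1, h2, h3⟩, fun z => ?_⟩
  rw [← (h4 z (by simpa using z.norm_lt_one)).tsum_eq, HardyDisc.eval_eq]
  refine tsum_congr fun n => ?_
  rw [InnerSeq.shifted, coeffs_ofNatCoeffs, h2, Nat.cast_zero, sub_zero]

theorem mem_mulSubspace_iff {φ : ℂ → ℂ} {s : InnerSeq} (hs : ∀ z : 𝔻, φ z = s.shifted 0 z)
    (f : HardyDisc) : f ∈ mulSubspace φ ↔ ∃ g, s.mulDisc g = f := by
  refine exists_congr fun g => ?_
  rw [DFunLike.ext_iff]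
  refine forall_congr' fun z => ?_
  rw [s.mulDisc_apply, hs, eq_comm]

/-- An inner function with a nontrivial model space is not constant. -/
theorem exists_coeff_ne_zero {φ : ℂ → ℂ} {s : InnerSeq} (hs : ∀ z : 𝔻, φ z = s.shifted 0 z)
    (h : modelSpace φ ≠ ⊥) : ∃ n : ℕ, s.coeff (n + 1) ≠ 0 := by
  by_contra! hn
  refine h ?_
  have hcoef (n : ℕ) : HardyDisc.coeffs (s.shifted 0) n = s.coeff n := by
    rw [InnerSeq.shifted, coeffs_ofNatCoeffs, s.translate_apply, Nat.cast_zero, sub_zero]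
  have hconst (z : 𝔻) : s.shifted 0 z = s.coeff 0 := by
    rw [HardyDisc.eval_eq, tsum_eq_single 0]
    · rw [hcoef]; simp
    · intro n hn0
      obtain ⟨m, rfl⟩ := Nat.exists_eq_succ_of_ne_zero hn0
      rw [hcoef, Nat.succ_eq_add_one, Nat.cast_add_one, hn, zero_mul]
  -- `φ` is a unit vector of `H²(𝔻)`, so as a constant it is nonzero and divides every function.
  have h0 : s.coeff 0 ≠ 0 := fun h0 => s.orthonormal_shifted.ne_zero 0 <|
    DFunLike.ext _ _ fun z => by rw [hconst, h0]; rfl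
  rw [modelSpace, show mulSubspace φ = ⊤ from ?_, Submodule.top_orthogonal_eq_bot]
  refine (Submodule.eq_top_iff').2 fun f => ⟨(s.coeff 0)⁻¹ • f, fun z => ?_⟩
  change f z = φ z * ((s.coeff 0)⁻¹ * f z)
  rw [hs, hconst, mul_inv_cancel_left₀ h0]

theorem adjoint_isometry_apply {E F : Type} [NormedAddCommGroup E] [InnerProductSpace ℂ E]
    [CompleteSpace E] [NormedAddCommGroup F] [InnerProductSpace ℂ F] [CompleteSpace F]
    (U : E →ₗᵢ[ℂ] F) (x : E) :
    ContinuousLinearMap.adjoint U.toContinuousLinearMap (U x) = x := by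
  refine ext_inner_left ℂ fun y => ?_
  rw [ContinuousLinearMap.adjoint_inner_right]
  exact U.inner_map_map y x

theorem HilbertBasis.ext_inner {ι E : Type} [NormedAddCommGroup E] [InnerProductSpace ℂ E]
    (b : HilbertBasis ι ℂ E) {x y : E} (h : ∀ i, inner ℂ (b i) x = inner ℂ (b i) y) : x = y :=
  b.repr.injective <| lp.ext <| funext fun i => by
    rw [b.repr_apply_apply, b.repr_apply_apply, h]

/-! ### Adjoints of the multiplications and commutation relations -/

namespace InnerSeq

/-- The adjoint of multiplication by `φ` on `H²(𝔻)`. -/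
def adjDisc (s : InnerSeq) : HardyDisc →L[ℂ] HardyDisc :=
  ContinuousLinearMap.adjoint s.mulDisc.toContinuousLinearMap

/-- The adjoint of multiplication by `φ(z)` on `H²(𝔻²)`. -/
def adjFst (s : InnerSeq) : HardyBidisc →L[ℂ] HardyBidisc :=
  ContinuousLinearMap.adjoint s.mulFst.toContinuousLinearMap

/-- The adjoint of multiplication by `φ(w)` on `H²(𝔻²)`. -/
def adjSnd (s : InnerSeq) : HardyBidisc →L[ℂ] HardyBidisc :=
  ContinuousLinearMap.adjoint s.mulSnd.toContinuousLinearMap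

variable (s t : InnerSeq)

theorem inner_adjDisc (f g : HardyDisc) : inner ℂ f (s.adjDisc g) = inner ℂ (s.mulDisc f) g :=
  ContinuousLinearMap.adjoint_inner_right _ _ _

theorem inner_adjFst (f g : HardyBidisc) : inner ℂ f (s.adjFst g) = inner ℂ (s.mulFst f) g :=
  ContinuousLinearMap.adjoint_inner_right _ _ _

theorem inner_adjSnd (f g : HardyBidisc) : inner ℂ f (s.adjSnd g) = inner ℂ (s.mulSnd f) g :=
  ContinuousLinearMap.adjoint_inner_right _ _ _

theorem adjFst_mulFst (f : HardyBidisc) : s.adjFst (s.mulFst f) = f :=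
  adjoint_isometry_apply _ _

theorem adjSnd_mulSnd (f : HardyBidisc) : s.adjSnd (s.mulSnd f) = f :=
  adjoint_isometry_apply _ _

theorem adjFst_elemTensor (f g : HardyDisc) :
    s.adjFst (elemTensor f g) = elemTensor (s.adjDisc f) g := by
  refine bidiscBasis.ext_inner fun k => ?_
  rw [inner_adjFst, ← elemTensor_discBasis, mulFst_elemTensor, inner_elemTensor, inner_elemTensor,
    inner_adjDisc]

theorem mulFst_mulSnd (f : HardyBidisc) : s.mulFst (t.mulSnd f) = t.mulSnd (s.mulFst f) :=
  DFunLike.ext _ _ fun p => by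
    rw [mulFst_apply, mulSnd_apply, mulSnd_apply, mulFst_apply, mul_left_comm]

/-- The operators act on different tensor factors; this is the double commutation on which the
decomposition and the functionals `α`, `β` rest. -/
theorem adjFst_mulSnd (f : HardyBidisc) : s.adjFst (t.mulSnd f) = t.mulSnd (s.adjFst f) := by
  have : s.adjFst.comp t.mulSnd.toContinuousLinearMap =
      t.mulSnd.toContinuousLinearMap.comp s.adjFst := by
    refine bidiscBasis.clm_ext fun k => ?_
    change s.adjFst (t.mulSnd (bidiscBasis k)) = t.mulSnd (s.adjFst (bidiscBasis k))
    rw [← elemTensor_discBasis, mulSnd_elemTensor, adjFst_elemTensor, adjFst_elemTensor,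
      mulSnd_elemTensor]
  exact DFunLike.congr_fun this f

theorem adjFst_adjSnd (f : HardyBidisc) : s.adjFst (t.adjSnd f) = t.adjSnd (s.adjFst f) := by
  refine ext_inner_left ℂ fun g => ?_
  rw [inner_adjFst, inner_adjSnd, inner_adjSnd, inner_adjFst, mulFst_mulSnd]

theorem mulFst_shiftZ (f : HardyBidisc) : shiftZ (s.mulFst f) = s.mulFst (shiftZ f) :=
  DFunLike.ext _ _ fun p => by
    rw [shiftZ_apply, mulFst_apply, mulFst_apply, shiftZ_apply, mul_left_comm]

theorem mulFst_shiftW (f : HardyBidisc) : shiftW (s.mulFst f) = s.mulFst (shiftW f) :=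
  DFunLike.ext _ _ fun p => by
    rw [shiftW_apply, mulFst_apply, mulFst_apply, shiftW_apply, mul_left_comm]

theorem mulSnd_shiftZ (f : HardyBidisc) : shiftZ (s.mulSnd f) = s.mulSnd (shiftZ f) :=
  DFunLike.ext _ _ fun p => by
    rw [shiftZ_apply, mulSnd_apply, mulSnd_apply, shiftZ_apply, mul_left_comm]

theorem mulSnd_shiftW (f : HardyBidisc) : shiftW (s.mulSnd f) = s.mulSnd (shiftW f) :=
  DFunLike.ext _ _ fun p => by
    rw [shiftW_apply, mulSnd_apply, mulSnd_apply, shiftW_apply, mul_left_comm]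

end InnerSeq

theorem shiftZ_shiftW (f : HardyBidisc) : shiftZ (shiftW f) = shiftW (shiftZ f) :=
  DFunLike.ext _ _ fun p => by
    rw [shiftZ_apply, shiftW_apply, shiftW_apply, shiftZ_apply, mul_left_comm]

theorem shift_pow_basis (k l : ℕ) :
    (shiftZ ^ k * shiftW ^ l) (bidiscBasis (0, 0)) = bidiscBasis (k, l) := by
  have hW : (shiftW ^ l) (bidiscBasis (0, 0)) = bidiscBasis (0, l) := by
    induction l with
    | zero => rfl
    | succ l ih => rw [pow_succ', mul_apply_eq_comp, ih, InnerSeq.shiftW_basis]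
  rw [mul_apply_eq_comp, hW]
  induction k with
  | zero => rfl
  | succ k ih => rw [pow_succ', mul_apply_eq_comp, ih, InnerSeq.shiftZ_basis]

/-! ### The submodule `(Q_φ ⊗ Q_ψ)ᗮ` -/

/-- For an isometry `M` with range `φ H²(𝔻)`, `1 - M M*` is the orthogonal projection onto the model
space. -/
theorem sub_mul_adj_mem_modelSpace {φ : ℂ → ℂ} {s : InnerSeq}
    (hs : ∀ z : 𝔻, φ z = s.shifted 0 z) (f : HardyDisc) :
    f - s.mulDisc (s.adjDisc f) ∈ modelSpace φ := by
  refine (Submodule.mem_orthogonal _ _).2 fun u hu => ?_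
  obtain ⟨g, rfl⟩ := (mem_mulSubspace_iff hs u).1 hu
  rw [inner_sub_right, LinearIsometry.inner_map_map, ← s.inner_adjDisc, sub_self]

theorem inner_mulDisc_of_mem_modelSpace {φ : ℂ → ℂ} {s : InnerSeq}
    (hs : ∀ z : 𝔻, φ z = s.shifted 0 z) {f : HardyDisc} (hf : f ∈ modelSpace φ) (g : HardyDisc) :
    inner ℂ f (s.mulDisc g) = 0 :=
  (Submodule.mem_orthogonal' _ _).1 hf _ ((mem_mulSubspace_iff hs _).2 ⟨g, rfl⟩)

theorem mem_tensorSubspace_orthogonal {A B : Submodule ℂ HardyDisc} {x : HardyBidisc} :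
    x ∈ (tensorSubspace A B)ᗮ ↔ ∀ f ∈ A, ∀ g ∈ B, inner ℂ (elemTensor f g) x = 0 := by
  rw [tensorSubspace, Submodule.orthogonal_closure]
  constructor
  · intro h f hf g hg
    exact (Submodule.mem_orthogonal _ _).1 h _ (Submodule.subset_span ⟨f, hf, g, hg, rfl⟩)
  · intro h
    refine (Submodule.mem_orthogonal _ _).2 fun u hu => ?_
    induction hu using Submodule.span_induction with
    | mem u hu =>
      obtain ⟨f, hf, g, hg, rfl⟩ := hu
      exact h f hf g hg
    | zero => exact inner_zero_left _
    | add u v _ _ hu hv => rw [inner_add_left, hu, hv, add_zero]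
    | smul c u _ hu => rw [inner_smul_left, hu, mul_zero]

section

variable {φ ψ : ℂ → ℂ} {s t : InnerSeq} (hs : ∀ z : 𝔻, φ z = s.shifted 0 z)
  (ht : ∀ z : 𝔻, ψ z = t.shifted 0 z)

include hs in
theorem mulFst_mem (x : HardyBidisc) :
    s.mulFst x ∈ (tensorSubspace (modelSpace φ) (modelSpace ψ))ᗮ := by
  refine mem_tensorSubspace_orthogonal.2 fun f hf g _ => ?_
  have : (innerSL ℂ (elemTensor f g)).comp s.mulFst.toContinuousLinearMap = 0 := by
    refine bidiscBasis.clm_ext fun k => ?_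
    change inner ℂ (elemTensor f g) (s.mulFst (bidiscBasis k)) = 0
    rw [← elemTensor_discBasis, s.mulFst_elemTensor, inner_elemTensor,
      inner_mulDisc_of_mem_modelSpace hs hf, zero_mul]
  exact DFunLike.congr_fun this x

include ht in
theorem mulSnd_mem (x : HardyBidisc) :
    t.mulSnd x ∈ (tensorSubspace (modelSpace φ) (modelSpace ψ))ᗮ := by
  refine mem_tensorSubspace_orthogonal.2 fun f _ g hg => ?_
  have : (innerSL ℂ (elemTensor f g)).comp t.mulSnd.toContinuousLinearMap = 0 := by
    refine bidiscBasis.clm_ext fun k => ?_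
    change inner ℂ (elemTensor f g) (t.mulSnd (bidiscBasis k)) = 0
    rw [← elemTensor_discBasis, t.mulSnd_elemTensor, inner_elemTensor,
      inner_mulDisc_of_mem_modelSpace ht hg, mul_zero]
  exact DFunLike.congr_fun this x

include hs ht in
-- Splitting each factor of a monomial along `H² = Q ⊕ φ H²` (resp. `ψ`) leaves terms in the range
-- of `Φ`, in the range of `Ψ`, or in `Q_φ ⊗ Q_ψ`, and `x` is orthogonal to all three.
theorem eq_zero_of_adj_eq_zero {x : HardyBidisc}
    (hx : x ∈ (tensorSubspace (modelSpace φ) (modelSpace ψ))ᗮ)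
    (h1 : s.adjFst x = 0) (h2 : t.adjSnd x = 0) : x = 0 := by
  have e1 (f g : HardyDisc) : inner ℂ (elemTensor (s.mulDisc f) g) x = 0 := by
    rw [← s.mulFst_elemTensor, ← s.inner_adjFst, h1, inner_zero_right]
  have e2 (f g : HardyDisc) : inner ℂ (elemTensor f (t.mulDisc g)) x = 0 := by
    rw [← t.mulSnd_elemTensor, ← t.inner_adjSnd, h2, inner_zero_right]
  refine bidiscBasis.ext_inner fun k => ?_
  have e3 := mem_tensorSubspace_orthogonal.1 hx
    _ (sub_mul_adj_mem_modelSpace hs (discBasis k.1))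
    _ (sub_mul_adj_mem_modelSpace ht (discBasis k.2))
  rw [inner_zero_right, ← elemTensor_discBasis]
  set f := discBasis k.1
  set g := discBasis k.2
  rw [← sub_add_cancel f (s.mulDisc (s.adjDisc f)),
    elemTensor_add_left, inner_add_left, e1, add_zero,
    ← sub_add_cancel g (t.mulDisc (t.adjDisc g)), elemTensor_add_right, inner_add_left, e2,
    add_zero, e3]

include hs ht in
-- Take `a = Φ* x` and `b = Ψ*(x - Φ a)`. Since `Φ*` commutes with `Ψ*`, `Φ* b = 0`; so both
-- adjoints kill the remainder, which lies in `S` and is therefore zero.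
theorem exists_eq_mulFst_add_mulSnd {x : HardyBidisc}
    (hx : x ∈ (tensorSubspace (modelSpace φ) (modelSpace ψ))ᗮ) :
    ∃ a b, x = s.mulFst a + t.mulSnd b := by
  set a := s.adjFst x
  set b := t.adjSnd (x - s.mulFst a) with hb
  have hb0 : s.adjFst b = 0 := by
    rw [hb, s.adjFst_adjSnd, map_sub, s.adjFst_mulFst, sub_self, map_zero]
  refine ⟨a, b, ?_⟩
  rw [← sub_eq_zero]
  refine eq_zero_of_adj_eq_zero hs ht
    (sub_mem hx (add_mem (mulFst_mem hs a) (mulSnd_mem ht b))) ?_ ?_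
  · rw [map_sub, map_add, s.adjFst_mulFst, s.adjFst_mulSnd, hb0, map_zero, add_zero, sub_self]
  · rw [← sub_sub, map_sub, t.adjSnd_mulSnd, ← hb, sub_self]

include hs ht in
theorem isShiftSubmodule_tensorSubspace_orthogonal :
    IsShiftSubmodule (tensorSubspace (modelSpace φ) (modelSpace ψ))ᗮ where
  isClosed := Submodule.isClosed_orthogonal _
  invariantZ f hf := by
    obtain ⟨a, b, rfl⟩ := exists_eq_mulFst_add_mulSnd hs ht hf
    rw [map_add, s.mulFst_shiftZ, t.mulSnd_shiftZ]
    exact add_mem (mulFst_mem hs _) (mulSnd_mem ht _)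
  invariantW f hf := by
    obtain ⟨a, b, rfl⟩ := exists_eq_mulFst_add_mulSnd hs ht hf
    rw [map_add, s.mulFst_shiftW, t.mulSnd_shiftW]
    exact add_mem (mulFst_mem hs _) (mulSnd_mem ht _)

/-! ### Generating sets for the restricted shifts -/

theorem coe_restrict_pow {H : Type} [NormedAddCommGroup H] [InnerProductSpace ℂ H]
    {S : Submodule ℂ H} {T : H →L[ℂ] H} (h : ∀ x ∈ S, T x ∈ S) (n : ℕ) (x : S) :
    (((T.restrict h) ^ n) x : H) = (T ^ n) x := by
  induction n with
  | zero => rfl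
  | succ n ih =>
    rw [pow_succ', pow_succ', mul_apply_eq_comp, mul_apply_eq_comp, ← ih]
    rfl

theorem coe_restrict_pow_mul_pow {H : Type} [NormedAddCommGroup H] [InnerProductSpace ℂ H]
    {S : Submodule ℂ H} {T₁ T₂ : H →L[ℂ] H} (h₁ : ∀ x ∈ S, T₁ x ∈ S) (h₂ : ∀ x ∈ S, T₂ x ∈ S)
    (k l : ℕ) (x : S) :
    (((T₁.restrict h₁) ^ k * (T₂.restrict h₂) ^ l) x : H) = (T₁ ^ k * T₂ ^ l) x := by
  rw [mul_apply_eq_comp, mul_apply_eq_comp, coe_restrict_pow, coe_restrict_pow]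

theorem shift_pow_mulFst (k l : ℕ) (f : HardyBidisc) :
    (shiftZ ^ k * shiftW ^ l) (s.mulFst f) = s.mulFst ((shiftZ ^ k * shiftW ^ l) f) := by
  have h1 : Commute shiftZ s.mulFst.toContinuousLinearMap := ContinuousLinearMap.ext s.mulFst_shiftZ
  have h2 : Commute shiftW s.mulFst.toContinuousLinearMap := ContinuousLinearMap.ext s.mulFst_shiftW
  exact DFunLike.congr_fun ((h1.pow_left k).mul_left (h2.pow_left l)) f

theorem shift_pow_mulSnd (k l : ℕ) (f : HardyBidisc) :
    (shiftZ ^ k * shiftW ^ l) (s.mulSnd f) = s.mulSnd ((shiftZ ^ k * shiftW ^ l) f) := by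
  have h1 : Commute shiftZ s.mulSnd.toContinuousLinearMap := ContinuousLinearMap.ext s.mulSnd_shiftZ
  have h2 : Commute shiftW s.mulSnd.toContinuousLinearMap := ContinuousLinearMap.ext s.mulSnd_shiftW
  exact DFunLike.congr_fun ((h1.pow_left k).mul_left (h2.pow_left l)) f

include hs ht in
/-- `φ ⊗ 1` and `1 ⊗ ψ` generate `(Q_φ ⊗ Q_ψ)ᗮ`. -/
theorem exists_generating_pair
    (h : IsShiftSubmodule (tensorSubspace (modelSpace φ) (modelSpace ψ))ᗮ) :
    ∃ x y, generatedSubspace (shiftZ.restrict h.invariantZ) (shiftW.restrict h.invariantW)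
      {x, y} = ⊤ := by
  let e : HardyBidisc := bidiscBasis (0, 0)
  refine ⟨⟨s.mulFst e, mulFst_mem hs e⟩, ⟨t.mulSnd e, mulSnd_mem ht e⟩, ?_⟩
  have : CompleteSpace (tensorSubspace (modelSpace φ) (modelSpace ψ))ᗮ :=
    h.isClosed.completeSpace_coe
  rw [generatedSubspace, Submodule.topologicalClosure_eq_top_iff, Submodule.eq_bot_iff]
  intro x hx
  rw [Submodule.mem_orthogonal] at hx
  have key (y) (hy : y ∈ ({⟨s.mulFst e, mulFst_mem hs e⟩, ⟨t.mulSnd e, mulSnd_mem ht e⟩} :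
      Set (tensorSubspace (modelSpace φ) (modelSpace ψ))ᗮ)) (k : ℕ × ℕ) :
      inner ℂ ((shiftZ ^ k.1 * shiftW ^ k.2) (y : HardyBidisc)) (x : HardyBidisc) = 0 := by
    rw [← coe_restrict_pow_mul_pow h.invariantZ h.invariantW]
    exact hx _ (Submodule.subset_span ⟨k.1, k.2, y, hy, rfl⟩)
  -- The orbit of `Φ 1` consists of the images under `Φ` of all monomials, so `x` orthogonal to it
  -- means `Φ* x = 0`; likewise for `Ψ`.
  refine Subtype.ext (eq_zero_of_adj_eq_zero hs ht x.2 ?_ ?_)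
  · refine bidiscBasis.ext_inner fun k => ?_
    have := key _ (Or.inl rfl) k
    rw [shift_pow_mulFst, shift_pow_basis] at this
    rw [s.inner_adjFst, this, inner_zero_right]
  · refine bidiscBasis.ext_inner fun k => ?_
    have := key _ (Or.inr rfl) k
    rw [shift_pow_mulSnd, shift_pow_basis] at this
    rw [t.inner_adjSnd, this, inner_zero_right]

include hs ht in
/-- `(Q_φ ⊗ Q_ψ)ᗮ` is not generated by a single function. -/
theorem generatedSubspace_ne_top (hφ0 : modelSpace φ ≠ ⊥) (hψ0 : modelSpace ψ ≠ ⊥)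
    (h : IsShiftSubmodule (tensorSubspace (modelSpace φ) (modelSpace ψ))ᗮ)
    {E : Set (tensorSubspace (modelSpace φ) (modelSpace ψ))ᗮ} (hE : E.Subsingleton) :
    generatedSubspace (shiftZ.restrict h.invariantZ) (shiftW.restrict h.invariantW) E ≠ ⊤ := by
  intro htop
  -- The empty set is absorbed by taking `F = 0`.
  obtain ⟨F, hF⟩ : ∃ F, E ⊆ {F} := by
    obtain rfl | ⟨F, rfl⟩ := hE.eq_empty_or_singleton
    · exact ⟨0, Set.empty_subset _⟩
    · exact ⟨F, subset_rfl⟩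
  obtain ⟨a, b, hab⟩ := exists_eq_mulFst_add_mulSnd hs ht F.2
  obtain ⟨m, hm⟩ := exists_coeff_ne_zero hs hφ0
  obtain ⟨n, hn⟩ := exists_coeff_ne_zero ht hψ0
  refine InnerSeq.hankelForm_ne_zero s t hm hn <| bilin_eq_zero_of_cyclic
    (Φ := s.mulFst.toContinuousLinearMap) (Ψ := t.mulSnd.toContinuousLinearMap)
    (ContinuousLinearMap.ext s.adjFst_mulFst) (ContinuousLinearMap.ext t.adjSnd_mulSnd)
    (ContinuousLinearMap.ext (s.mulFst_mulSnd t)) (ContinuousLinearMap.ext (s.adjFst_mulSnd t))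
    (ContinuousLinearMap.ext shiftZ_shiftW)
    (ContinuousLinearMap.ext s.mulFst_shiftZ) (ContinuousLinearMap.ext t.mulSnd_shiftZ)
    (ContinuousLinearMap.ext s.mulFst_shiftW) (ContinuousLinearMap.ext t.mulSnd_shiftW)
    (InnerSeq.hankelForm_symm s t) (InnerSeq.hankelForm_shiftZ s t)
    (InnerSeq.hankelForm_shiftW s t) (InnerSeq.hankelForm_mulFst s t)
    (InnerSeq.hankelForm_mulSnd s t) (mulFst_mem (ψ := ψ) hs) (mulSnd_mem ht) a b
    fun Λ hΛ x hx => ?_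
  let Λ' := Λ.comp (tensorSubspace (modelSpace φ) (modelSpace ψ))ᗮ.subtypeL
  -- A functional that vanishes on the orbit of `F` has a closed kernel, so it vanishes on the
  -- subspace generated by `E`, which is all of `S`.
  have hle : generatedSubspace (shiftZ.restrict h.invariantZ) (shiftW.restrict h.invariantW) E ≤
      LinearMap.ker Λ'.toLinearMap := by
    refine Submodule.topologicalClosure_minimal _ (Submodule.span_le.2 ?_) Λ'.isClosed_ker
    rintro _ ⟨k, l, y, hy, rfl⟩
    obtain rfl : y = F := hF hy
    change Λ (((shiftZ.restrict h.invariantZ) ^ k * (shiftW.restrict h.invariantW) ^ l) y :) = 0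
    rw [coe_restrict_pow_mul_pow, hab]
    exact hΛ k l
  exact hle (htop ▸ Submodule.mem_top : (⟨x, hx⟩ : (tensorSubspace _ _)ᗮ) ∈ _)

end

end

theorem theorem2p2 (φ ψ : ℂ → ℂ) (hφ : IsInner φ) (hψ : IsInner ψ)
    (hφ0 : modelSpace φ ≠ ⊥) (hψ0 : modelSpace ψ ≠ ⊥) :
    ∃ h : IsShiftSubmodule (tensorSubspace (modelSpace φ) (modelSpace ψ))ᗮ, h.rank = 2 := by
  obtain ⟨s, hs⟩ := hφ.exists_innerSeq
  obtain ⟨t, ht⟩ := hψ.exists_innerSeq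
  have h := isShiftSubmodule_tensorSubspace_orthogonal hs ht
  refine ⟨h, ?_⟩
  obtain ⟨x, y, hxy⟩ := exists_generating_pair hs ht h
  rw [IsShiftSubmodule.rank, pairRank]
  refine le_antisymm (le_trans (csInf_le' (a := Cardinal.mk ({x, y} : Set _)) ⟨_, hxy, rfl⟩) ?_)
    (le_csInf ⟨_, {x, y}, hxy, rfl⟩ ?_)
  -- Only `≤ 2` is needed here; `x` and `y` need not be known to differ.
  · refine (Cardinal.mk_insert_le).trans ?_
    rw [Cardinal.mk_singleton, one_add_one_eq_two]
  · rintro _ ⟨E, hE, rfl⟩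
    by_contra hlt
    rw [Cardinal.two_le_iff] at hlt
    push Not at hlt
    exact generatedSubspace_ne_top hs ht hφ0 hψ0 h (E := E)
      (fun a ha b hb => congrArg Subtype.val (hlt ⟨a, ha⟩ ⟨b, hb⟩)) hE
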